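/- A basic sequence is a sequence $Q=(q_i)_{i\ge 1}$ of integers $q_i\ge 2$. Every real $x$ has a unique $Q$-Cantor series expansion $x=a_0+\sum_{i\ge 1}\frac{a_i}{q_1q_2\cdots q_i}$ with $a_0=\lfloor x\rfloor$, $a_i\in\{0,\dots,q_i-1\}$ for $i\ge 1$, and $a_i\ne q_i-1$ for infinitely many $i$. A block is a finite nonempty sequence $B=(e_1,\dots,e_k)$ of natural numbers; write $|B|=k$ and $B(t)=e_t$. Let $$Q_n(B)=\sum_{j=1}^n \frac{\mathcal I_j(B)}{q_jq_{j+1}\cdots q_{j+k-1}},$$ where $\mathcal I_j(B)=1$ if $e_1<q_j,\ e_2<q_{j+1},\dots,e_k<q_{j+k-1}$ and $\mathcal I_j(B)=0$ otherwise; $B$ has infinite expectation if $\lim_{n\to\infty}Q_n(B)=\infty$. Let $N_n^Q(B,x)$ be the number of $i$ with $1\le i\le n$ such that $(a_i,\dots,a_{i+k-1})=B$. A set is $\mathbf\Pi^0_3$-complete if it is $\mathbf\Pi^0_3$ but not $\mathbf\Sigma^0_3$ in $\mathbb R$. **Theorem.** Let $Q$ be a basic sequence and $\mathscr C$ a collection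 of blocks. The set $$\mathscr N_{\mathscr C}(Q)=\Big\{x\in\mathbb R:\ \lim_{n\to\infty}\frac{N_n^Q(B,x)}{Q_n(B)}=1\ \text{ for all } B\in\mathscr C \text{ such that } \lim_{n\to\infty}Q_n(B)=\infty\Big\}$$ is $\mathbf\Pi^0_3$-complete if there exists $B\in\mathscr C$ with $\lim_{n\to\infty}Q_n(B)=\infty$, and clopen otherwise. The set $$\mathscr{RN}_{\mathscr C}(Q)=\Big\{x\in\mathbb R:\ \lim_{n\to\infty}\frac{N_n^Q(B_1,x)/Q_n(B_1)}{N_n^Q(B_2,x)/Q_n(B_2)}=1\ \text{ for all } B_1,B_2\in\mathscr C \text{ such that } |B_1|=|B_2| \text{ and } \lim_{n\to\infty}\min(Q_n(B_1),Q_n(B_2))=\infty\Big\}$$ is $\mathbf\Pi^0_3$-complete if there exist $B_1,B_2\in\mathscr C$ (not necessarily distinct) such that $\lim_{n\to\infty}\min(Q_n(B_1),Q_n(B_2))=\infty$ and $\mathscr C$ satisfies the following hypothesis: $(\star)$ For every $B\in\mathscr C$ with infinite expectation there are a block $B'\in\mathscr C$ of infinite expectation with $|B'|=|B|$ and an integer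 $1\le t\le|B|$ such that $|B(t)-B'(t')|>1$ for all $1\le t'\le|B'|$. If there do not exist $B_1,B_2\in\mathscr C$ (not necessarily distinct) such that $\lim_{n\to\infty}\min(Q_n(B_1),Q_n(B_2))=\infty$, then $\mathscr{RN}_{\mathscr C}(Q)$ is clopen. -/

import Mathlib

open Filter Topology

/-! # Borel hierarchy, finite levels -/

/-- The pointclasses `Σ⁰ₙ` (`n ≥ 1`) of a topological space: `Σ⁰₁` is the class of open sets, and
a set is `Σ⁰ₙ`, `n > 1`, if it is a countable union of sets `A i`, each of which is `Π⁰_{m i}`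
(that is, has a `Σ⁰_{m i}` complement) for some `1 ≤ m i < n`. -/
inductive IsSigmaZero {X : Type*} [TopologicalSpace X] : ℕ → Set X → Prop
  | of_isOpen {U : Set X} (hU : IsOpen U) : IsSigmaZero 1 U
  | iUnion {n : ℕ} (A : ℕ → Set X) (m : ℕ → ℕ) (hm : ∀ i, 1 ≤ m i ∧ m i < n)
      (hA : ∀ i, IsSigmaZero (m i) (A i)ᶜ) : IsSigmaZero n (⋃ i, A i)

/-- The pointclasses `Π⁰ₙ`: complements of `Σ⁰ₙ` sets. -/
def IsPiZero {X : Type*} [TopologicalSpace X] (n : ℕ) (A : Set X) : Prop :=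
  IsSigmaZero n Aᶜ

/-- A set is `Π⁰ₙ`-complete if it is `Π⁰ₙ` but not `Σ⁰ₙ`. -/
def IsPiZeroComplete {X : Type*} [TopologicalSpace X] (n : ℕ) (A : Set X) : Prop :=
  IsPiZero n A ∧ ¬ IsSigmaZero n A

/-! # Cantor series expansions

Sequences are indexed from `0`: the value `Q i` is the base `q_{i+1}`, and `cantorDigit Q x i` is
the digit `a_{i+1}`. -/

/-- A basic sequence: a sequence of integers that are at least `2`. -/
def IsBasicSequence (Q : ℕ → ℕ) : Prop :=
  ∀ i, 2 ≤ Q i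

/-- The digits of the `Q`-Cantor series expansion `x = ⌊x⌋ + ∑ i, a i / (Q 0 * ⋯ * Q i)`; that
these are the digits of the expansion is `isCantorExpansion_iff` below. -/
noncomputable def cantorDigit (Q : ℕ → ℕ) (x : ℝ) (i : ℕ) : ℕ :=
  ⌊(Q i : ℝ) * Int.fract ((∏ j ∈ Finset.range i, (Q j : ℝ)) * x)⌋₊

/-- `a₀ + ∑ i, a i / (Q 0 * ⋯ * Q i)` is the `Q`-Cantor series expansion of `x`. -/
def IsCantorExpansion (Q : ℕ → ℕ) (x : ℝ) (a₀ : ℤ) (a : ℕ → ℕ) : Prop :=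
  a₀ = ⌊x⌋ ∧ (∀ i, a i < Q i) ∧ (∃ᶠ i in atTop, a i ≠ Q i - 1) ∧
    HasSum (fun i => (a i : ℝ) / ∏ j ∈ Finset.range (i + 1), (Q j : ℝ)) (x - a₀)

theorem cantorDigit_isCantorExpansion {Q : ℕ → ℕ} (hQ : IsBasicSequence Q) (x : ℝ) :
    IsCantorExpansion Q x ⌊x⌋ (cantorDigit Q x) := by
  set P : ℕ → ℝ := fun n => ∏ j ∈ Finset.range n, (Q j : ℝ) with hP
  set T : ℕ → ℝ := fun n => Int.fract (P n * x) with hT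
  have hQ2 : ∀ i, (2 : ℝ) ≤ Q i := fun i => by exact_mod_cast hQ i
  have hPs : ∀ n, P (n + 1) = P n * Q n := fun n => Finset.prod_range_succ _ _
  have hPpow : ∀ n, (2 : ℝ) ^ n ≤ P n := by
    intro n
    induction n with
    | zero => simp [hP]
    | succ n ih =>
      rw [hPs, pow_succ]
      exact mul_le_mul ih (hQ2 n) (by norm_num) (le_trans (by positivity) ih)
  have hPpos : ∀ n, 0 < P n := fun n => lt_of_lt_of_le (by positivity) (hPpow n)
  have hT0 : ∀ n, 0 ≤ T n := fun n => Int.fract_nonneg _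
  have hT1 : ∀ n, T n < 1 := fun n => Int.fract_lt_one _
  have hrec : ∀ n, (Q n : ℝ) * T n = cantorDigit Q x n + T (n + 1) := by
    intro n
    have h1 : (0 : ℝ) ≤ Q n * T n := mul_nonneg (by positivity) (hT0 n)
    have h2 : (cantorDigit Q x n : ℝ) = ((⌊(Q n : ℝ) * T n⌋ : ℤ) : ℝ) :=
      natCast_floor_eq_intCast_floor h1
    have h3 : T (n + 1) = Int.fract ((Q n : ℝ) * T n) := by
      have : P (n + 1) * x = Q n * T n + ((Q n * ⌊P n * x⌋ : ℤ) : ℝ) := by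
        have h4 : P n * x = ⌊P n * x⌋ + T n := (Int.floor_add_fract _).symm
        rw [hPs]
        push_cast
        linear_combination (Q n : ℝ) * h4
      simp only [hT] at this ⊢
      rw [this, Int.fract_add_intCast]
    rw [h2, h3, Int.floor_add_fract]
  have hlt : ∀ i, cantorDigit Q x i < Q i := by
    intro i
    have h1 := hrec i
    have h2 := hT0 (i + 1)
    have h3 := hT1 i
    have h4 := hQ2 i
    have : (cantorDigit Q x i : ℝ) < Q i := by nlinarith
    exact_mod_cast this
  refine ⟨rfl, hlt, ?_, ?_⟩
  · intro hev
    obtain ⟨N, hN⟩ := eventually_atTop.1 hev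
    have hstep : ∀ m, (2 : ℝ) ^ m * (1 - T N) ≤ 1 - T (N + m) := by
      intro m
      induction m with
      | zero => simp
      | succ m ih =>
        have h1 := hrec (N + m)
        have h2 : cantorDigit Q x (N + m) = Q (N + m) - 1 := not_not.1 (hN (N + m) (by omega))
        have h3 : (cantorDigit Q x (N + m) : ℝ) = Q (N + m) - 1 := by
          rw [h2, Nat.cast_sub (by have := hQ (N + m); omega)]
          simp
        have h4 : 1 - T (N + (m + 1)) = Q (N + m) * (1 - T (N + m)) := by
          rw [← add_assoc]; linarith
        rw [h4, pow_succ]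
        have h5 := hQ2 (N + m)
        have h6 := hT1 (N + m)
        nlinarith
    obtain ⟨m, hm⟩ := pow_unbounded_of_one_lt (1 / (1 - T N)) (one_lt_two (α := ℝ))
    have h1 : 0 < 1 - T N := by linarith [hT1 N]
    rw [div_lt_iff₀ h1] at hm
    linarith [hstep m, hT0 (N + m)]
  · have hsum : ∀ n, ∑ i ∈ Finset.range n, (cantorDigit Q x i : ℝ) / P (i + 1)
        = (x - ⌊x⌋) - T n / P n := by
      intro n
      induction n with
      | zero => simp [hP, hT]
      | succ n ih =>
        rw [Finset.sum_range_succ, ih]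
        have h1 : (cantorDigit Q x n : ℝ) = Q n * T n - T (n + 1) := by linarith [hrec n]
        have h2 := (hPpos n).ne'
        have h3 : (Q n : ℝ) ≠ 0 := by linarith [hQ2 n]
        rw [h1, hPs]
        field_simp
        ring
    rw [hasSum_iff_tendsto_nat_of_nonneg (fun i => div_nonneg (by positivity) (hPpos _).le)]
    have hlim : Tendsto (fun n => T n / P n) atTop (𝓝 0) := by
      refine squeeze_zero (fun n => div_nonneg (hT0 n) (hPpos n).le) (fun n => ?_)
        (tendsto_pow_atTop_nhds_zero_of_lt_one (r := (1 / 2 : ℝ)) (by norm_num) (by norm_num))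
      rw [one_div_pow]
      exact div_le_div₀ zero_le_one (hT1 n).le (by positivity) (hPpow n)
    have := (tendsto_const_nhds (x := x - ⌊x⌋)).sub hlim
    rw [sub_zero] at this
    exact this.congr (fun n => (hsum n).symm)

theorem isCantorExpansion_iff {Q : ℕ → ℕ} (hQ : IsBasicSequence Q) (x : ℝ) (a₀ : ℤ)
    (a : ℕ → ℕ) : IsCantorExpansion Q x a₀ a ↔ a₀ = ⌊x⌋ ∧ a = cantorDigit Q x := by
  refine ⟨?_, fun h => h.1 ▸ h.2 ▸ cantorDigit_isCantorExpansion hQ x⟩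
  rintro ⟨h0, hlt, hfr, hs⟩
  refine ⟨h0, ?_⟩
  set P : ℕ → ℝ := fun n => ∏ j ∈ Finset.range n, (Q j : ℝ) with hP
  have hQ2 : ∀ i, (2 : ℝ) ≤ Q i := fun i => by exact_mod_cast hQ i
  have hPs : ∀ n, P (n + 1) = P n * Q n := fun n => Finset.prod_range_succ _ _
  have hPpos : ∀ n, 0 < P n := fun n =>
    Finset.prod_pos fun j _ => by linarith [hQ2 j]
  set S : ℕ → ℝ := fun n => ∑ i ∈ Finset.range n, (a i : ℝ) / P (i + 1) with hS
  have hSs : ∀ n, S (n + 1) = S n + a n / P (n + 1) := fun n => Finset.sum_range_succ _ _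
  have hnn : ∀ i, 0 ≤ (a i : ℝ) / P (i + 1) := fun i => div_nonneg (by positivity) (hPpos _).le
  set R : ℕ → ℝ := fun n => P n * (x - a₀ - S n) with hR
  have hSle : ∀ n, S n ≤ x - a₀ := fun n => sum_le_hasSum _ (fun i _ => hnn i) hs
  have hR0 : ∀ n, 0 ≤ R n := fun n => mul_nonneg (hPpos n).le (by linarith [hSle n])
  have ha1 : ∀ i, (a i : ℝ) + 1 ≤ Q i := fun i => by exact_mod_cast hlt i
  have hRs : ∀ n, R (n + 1) = Q n * R n - a n := by
    intro n
    have h2 := (hPpos n).ne'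
    have h3 : (Q n : ℝ) ≠ 0 := by linarith [hQ2 n]
    simp only [hR]
    rw [hSs, hPs]
    field_simp
    ring
  have hanti : Antitone fun n => S n + 1 / P n := by
    refine antitone_nat_of_succ_le fun n => ?_
    have h1 : 1 / P n = Q n / P (n + 1) := by
      have h2 := (hPpos n).ne'
      have h3 : (Q n : ℝ) ≠ 0 := by linarith [hQ2 n]
      rw [hPs]
      field_simp
    rw [hSs, h1, add_assoc, ← add_div]
    have h2 : ((a n : ℝ) + 1) / P (n + 1) ≤ Q n / P (n + 1) :=
      div_le_div_of_nonneg_right (ha1 n) (hPpos _).le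
    linarith
  have hR1 : ∀ n, R n ≤ 1 := by
    intro n
    have hle : x - a₀ ≤ S n + 1 / P n := by
      refine le_of_tendsto hs.tendsto_sum_nat (eventually_atTop.2 ⟨n, fun m hm => ?_⟩)
      have h1 := hanti hm
      have h2 : 0 < 1 / P m := one_div_pos.2 (hPpos m)
      change S m ≤ _
      simp only at h1
      linarith
    have h1 : P n * (x - a₀ - S n) ≤ P n * (1 / P n) :=
      mul_le_mul_of_nonneg_left (by linarith) (hPpos n).le
    rwa [mul_one_div_cancel (hPpos n).ne'] at h1
  have hRlt : ∀ n, R n < 1 := by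
    intro n
    by_contra hcon
    have hall : ∀ m, R (n + m) = 1 := by
      intro m
      induction m with
      | zero => exact le_antisymm (hR1 n) (not_lt.1 hcon)
      | succ m ih =>
        have h1 := hRs (n + m)
        rw [ih] at h1
        refine le_antisymm (hR1 _) ?_
        rw [← add_assoc, h1]
        linarith [ha1 (n + m)]
    refine hfr (eventually_atTop.2 ⟨n, fun k hk => not_not.2 ?_⟩)
    obtain ⟨m, rfl⟩ := Nat.exists_eq_add_of_le hk
    have h1 := hRs (n + m)
    rw [hall m, add_assoc, hall (m + 1)] at h1
    have h2 : ((a (n + m) + 1 : ℕ) : ℝ) = (Q (n + m) : ℕ) := by push_cast; linarith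
    have h3 : a (n + m) + 1 = Q (n + m) := by exact_mod_cast h2
    omega
  have hint : ∀ n, ∃ z : ℤ, P n * S n = z := by
    intro n
    induction n with
    | zero => exact ⟨0, by simp [hS]⟩
    | succ n ih =>
      obtain ⟨z, hz⟩ := ih
      refine ⟨Q n * z + a n, ?_⟩
      rw [hSs, mul_add, mul_div_cancel₀ _ (hPpos _).ne', hPs]
      push_cast
      linear_combination (Q n : ℝ) * hz
  have hPint : ∀ n, ∃ z : ℤ, P n = z := fun n =>
    ⟨((∏ j ∈ Finset.range n, Q j : ℕ) : ℤ), by simp [hP]⟩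
  have hfract : ∀ n, Int.fract (P n * x) = R n := by
    intro n
    obtain ⟨z, hz⟩ := hint n
    obtain ⟨w, hw⟩ := hPint n
    refine Int.fract_eq_iff.2 ⟨hR0 n, hRlt n, w * a₀ + z, ?_⟩
    push_cast
    rw [← hz, ← hw]
    simp only [hR]
    ring
  funext n
  have h1 : cantorDigit Q x n = ⌊(Q n : ℝ) * R n⌋₊ := by
    rw [← hfract n]; rfl
  rw [h1, eq_comm, Nat.floor_eq_iff (mul_nonneg (by positivity) (hR0 n))]
  constructor <;> linarith [hRs n, hR0 (n + 1), hRlt (n + 1)]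

/-! # Blocks and normality

A block is a finite sequence of natural numbers, here a `List ℕ`. -/

/-- `expectedCount Q B n = ∑ I_j(B) / (q_j ⋯ q_{j+k-1})`, the sum over the first `n` starting
positions `j`, where `k = |B|` and `I_j(B)` is `1` if every entry of `B` placed at `j` is smaller
than the corresponding base, and `0` otherwise. -/
noncomputable def expectedCount (Q : ℕ → ℕ) (B : List ℕ) (n : ℕ) : ℝ :=
  ∑ j ∈ Finset.range n,
    (if ∀ t : Fin B.length, B.get t < Q (j + t) then (1 : ℝ) else 0) /
      ∏ t ∈ Finset.range B.length, (Q (j + t) : ℝ)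

/-- A block has infinite expectation if its expected counts tend to infinity. -/
def HasInfiniteExpectation (Q : ℕ → ℕ) (B : List ℕ) : Prop :=
  Tendsto (expectedCount Q B) atTop atTop

/-- The number of occurrences of the block `B` among the digits of `x` after the point, with a
start in the first `n` positions. -/
noncomputable def blockCount (Q : ℕ → ℕ) (B : List ℕ) (x : ℝ) (n : ℕ) : ℕ :=
  ((Finset.range n).filter fun i =>
    ∀ t : Fin B.length, cantorDigit Q x (i + t) = B.get t).card

/-- The numbers that are normal with respect to the blocks of `C` of infinite expectation. -/
def normalSet (Q : ℕ → ℕ) (C : Set (List ℕ)) : Set ℝ :=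
  {x | ∀ B ∈ C, HasInfiniteExpectation Q B →
    Tendsto (fun n => (blockCount Q B x n : ℝ) / expectedCount Q B n) atTop (𝓝 1)}

/-- The two blocks have infinite expectation together: the minimum of their expected counts tends
to infinity. -/
def JointlyInfiniteExpectation (Q : ℕ → ℕ) (B₁ B₂ : List ℕ) : Prop :=
  Tendsto (fun n => min (expectedCount Q B₁ n) (expectedCount Q B₂ n)) atTop atTop

/-- The numbers that are ratio normal with respect to the blocks of `C`. (Since `y / 0 = 0`, the
limit being `1` includes that the quotient is eventually defined, with a nonzero denominator.) -/
def ratioNormalSet (Q : ℕ → ℕ) (C : Set (List ℕ)) : Set ℝ :=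
  {x | ∀ B₁ ∈ C, ∀ B₂ ∈ C, B₁.length = B₂.length → JointlyInfiniteExpectation Q B₁ B₂ →
    Tendsto (fun n => ((blockCount Q B₁ x n : ℝ) / expectedCount Q B₁ n) /
      ((blockCount Q B₂ x n : ℝ) / expectedCount Q B₂ n)) atTop (𝓝 1)}

/-- The separation hypothesis on a collection of blocks: for every `B ∈ C` of infinite
expectation there are `B' ∈ C` of infinite expectation and of the same length, and a position `t`,
such that `B(t)` differs by more than `1` from every entry of `B'`. -/
def StarCondition (Q : ℕ → ℕ) (C : Set (List ℕ)) : Prop :=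
  ∀ B ∈ C, HasInfiniteExpectation Q B →
    ∃ B' ∈ C, HasInfiniteExpectation Q B' ∧ B'.length = B.length ∧
      ∃ t : Fin B.length, ∀ t' : Fin B'.length, 1 < |(B.get t : ℤ) - (B'.get t' : ℤ)|

/-! # Closure properties of the pointclasses -/

theorem IsSigmaZero.preimage {X Y : Type*} [TopologicalSpace X] [TopologicalSpace Y] {f : X → Y}
    (hf : Continuous f) {n : ℕ} {A : Set Y} (hA : IsSigmaZero n A) : IsSigmaZero n (f ⁻¹' A) := by
  induction hA with
  | of_isOpen hU => exact .of_isOpen (hU.preimage hf)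
  | iUnion A m hm _ ih =>
    rw [Set.preimage_iUnion]
    exact .iUnion _ m hm ih

theorem IsSigmaZero.isOpen_of_one {X : Type*} [TopologicalSpace X] {A : Set X}
    (hA : IsSigmaZero 1 A) : IsOpen A := by
  cases hA with
  | of_isOpen hU => exact hU
  | iUnion A m hm _ => exact absurd (hm 0) (by omega)

theorem IsSigmaZero.isGδ_compl_of_two {X : Type*} [TopologicalSpace X] {A : Set X}
    (hA : IsSigmaZero 2 A) : IsGδ Aᶜ := by
  cases hA with
  | iUnion A m hm hA =>
    rw [Set.compl_iUnion]
    refine IsGδ.iInter fun i => ?_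
    have h1 : m i = 1 := by have := hm i; omega
    exact (h1 ▸ hA i).isOpen_of_one.isGδ

/-- In a perfectly normal space a `Σ⁰₃` set is a countable union of `Gδ` sets. -/
theorem IsSigmaZero.exists_isGδ_of_three {X : Type*} [TopologicalSpace X] [PerfectlyNormalSpace X]
    {A : Set X} (hA : IsSigmaZero 3 A) : ∃ G : ℕ → Set X, (∀ i, IsGδ (G i)) ∧ A = ⋃ i, G i := by
  cases hA with
  | iUnion A m hm hA =>
    refine ⟨A, fun i => ?_, rfl⟩
    have h := hA i
    obtain h1 | h1 : m i = 1 ∨ m i = 2 := by have := hm i; omega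
    · rw [h1] at h
      exact (isOpen_compl_iff.1 h.isOpen_of_one).isGδ
    · rw [h1] at h
      simpa using h.isGδ_compl_of_two

theorem isSigmaZero_sUnion {X : Type*} [TopologicalSpace X] {n : ℕ} (hn : 1 < n)
    {S : Set (Set X)} (hS : S.Countable)
    (h : ∀ s ∈ S, ∃ m, (1 ≤ m ∧ m < n) ∧ IsSigmaZero m sᶜ) : IsSigmaZero n (⋃₀ S) := by
  obtain ⟨A, hA⟩ := (hS.insert ∅).exists_eq_range (Set.insert_nonempty _ _)
  have key : ∀ i, ∃ m, (1 ≤ m ∧ m < n) ∧ IsSigmaZero m (A i)ᶜ := by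
    intro i
    have hi : A i ∈ insert ∅ S := hA ▸ Set.mem_range_self i
    rcases hi with hi | hi
    · exact ⟨1, ⟨le_rfl, hn⟩, by rw [hi, Set.compl_empty]; exact .of_isOpen isOpen_univ⟩
    · exact h _ hi
  choose m hm hA' using key
  have : ⋃₀ S = ⋃ i, A i := by
    rw [← Set.sUnion_range, ← hA, Set.sUnion_insert, Set.empty_union]
  rw [this]
  exact .iUnion A m hm hA'

/-- The set of common convergence to `1` of countably many sequences of real functions, all of
them continuous off one countable set, is `Π⁰₃`. -/
theorem isPiZero_three_setOf_tendsto {X : Type*} [TopologicalSpace X] [T1Space X]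
    {D : Set X} (hD : D.Countable) {ι : Type*} [Countable ι] (f : ι → ℕ → X → ℝ)
    (hf : ∀ i n, ContinuousOn (f i n) Dᶜ) :
    IsPiZero 3 {x | ∀ i, Tendsto (fun n => f i n x) atTop (𝓝 1)} := by
  have hF : ∀ i n (k : ℕ), ∃ F : Set X, IsClosed F ∧
      f i n ⁻¹' Metric.closedBall 1 (1 / (k + 1)) ∩ Dᶜ = F ∩ Dᶜ := fun i n k =>
    continuousOn_iff_isClosed.1 (hf i n) _ Metric.isClosed_closedBall
  choose F hFc hFe using hF
  have hFm : ∀ x ∉ D, ∀ i n k, x ∈ F i n k ↔ dist (f i n x) 1 ≤ 1 / (k + 1) := by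
    intro x hx i n k
    have := Set.ext_iff.1 (hFe i n k) x
    simpa [hx] using this.symm
  set N : Set X := {x | ∀ i, Tendsto (fun n => f i n x) atTop (𝓝 1)} with hN
  set G : ι × ℕ → Set X := fun p => Dᶜ ∩ ⋂ M : ℕ, ⋃ n : {n // M ≤ n}, (F p.1 n p.2)ᶜ with hG
  have hNe : Nᶜ = ⋃₀ ((fun x => {x}) '' (D ∩ Nᶜ) ∪ Set.range G) := by
    ext x
    by_cases hx : x ∈ D
    · simp [hx, hG, Set.sUnion_union]
    · have h1 : x ∈ N ↔ ∀ i (k : ℕ), ∃ M, ∀ n ≥ M, dist (f i n x) 1 ≤ 1 / (k + 1) := by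
        simp only [hN, Set.mem_ofPred_eq]
        refine forall_congr' fun i => ?_
        rw [Metric.nhds_basis_closedBall.tendsto_right_iff]
        constructor
        · intro h k
          exact eventually_atTop.1 (h _ (by positivity))
        · intro h ε hε
          obtain ⟨k, hk⟩ := exists_nat_one_div_lt hε
          obtain ⟨M, hM⟩ := h k
          exact eventually_atTop.2 ⟨M, fun n hn => (hM n hn).trans hk.le⟩
      rw [Set.mem_compl_iff, h1]
      simp [hx, hG, hFm x hx, Set.sUnion_union]
  rw [IsPiZero, hNe]
  refine isSigmaZero_sUnion (by norm_num)
    (((hD.mono Set.inter_subset_left).image _).union (Set.countable_range G)) ?_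
  rintro s (⟨x, _, rfl⟩ | ⟨p, rfl⟩)
  · exact ⟨1, by norm_num, .of_isOpen isClosed_singleton.isOpen_compl⟩
  · refine ⟨2, by norm_num, ?_⟩
    have : (G p)ᶜ = ⋃₀ ((fun x => {x}) '' D ∪
        Set.range fun M : ℕ => ⋂ n : {n // M ≤ n}, F p.1 n p.2) := by
      ext x
      by_cases hx : x ∈ D <;> simp [hx, hG, Set.sUnion_union]
    rw [this]
    refine isSigmaZero_sUnion (by norm_num) ((hD.image _).union (Set.countable_range _)) ?_
    rintro s (⟨x, _, rfl⟩ | ⟨M, rfl⟩)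
    · exact ⟨1, by norm_num, .of_isOpen isClosed_singleton.isOpen_compl⟩
    · exact ⟨1, by norm_num, .of_isOpen (isClosed_iInter fun n => hFc _ _ _).isOpen_compl⟩

/-! # Sequences tending to infinity in the Baire space -/

theorem exists_seq_of_forall_exists_rel {α : Type*} (a₀ : α) (R : ℕ → α → α → Prop)
    (h : ∀ i a, ∃ b, R i a b) : ∃ s : ℕ → α, s 0 = a₀ ∧ ∀ i, R i (s i) (s (i + 1)) := by
  choose g hg using h
  exact ⟨fun n => Nat.rec a₀ g n, rfl, fun i => hg i _⟩

/-- Coherent longer and longer initial segments have a common continuation. -/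
theorem exists_forall_eq_of_coherent {γ : ℕ → ℕ → ℕ} {l : ℕ → ℕ} (hl : StrictMono l)
    (h : ∀ k, ∀ i < l k, γ (k + 1) i = γ k i) :
    ∃ β : ℕ → ℕ, ∀ k, ∀ i < l k, β i = γ k i := by
  have h2 : ∀ k d, ∀ i < l k, γ (k + d) i = γ k i := by
    intro k d
    induction d with
    | zero => simp
    | succ d ih =>
      intro i hi
      rw [← add_assoc, h _ i (hi.trans_le (hl.monotone (by omega))), ih i hi]
  refine ⟨fun i => γ (i + 1) i, fun k i hi => ?_⟩
  have h3 : i < l (i + 1) := (Nat.lt_succ_self i).trans_le (hl.id_le _)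
  rcases le_total k (i + 1) with hk | hk
  · obtain ⟨d, hd⟩ := Nat.exists_eq_add_of_le hk
    simp only [hd]
    exact h2 k d i hi
  · obtain ⟨d, hd⟩ := Nat.exists_eq_add_of_le hk
    rw [hd]
    exact (h2 _ d i h3).symm

/-- The sequences that agree with `β` before `n` and are at least `m` from `n` on. -/
def boundedTail (β : ℕ → ℕ) (n m : ℕ) : Set (ℕ → ℕ) :=
  {γ | (∀ i < n, γ i = β i) ∧ ∀ i ≥ n, m ≤ γ i}

theorem boundedTail_subset {β γ : ℕ → ℕ} {n m l M : ℕ} (hγ : γ ∈ boundedTail β n m) (hl : n ≤ l)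
    (hM : m ≤ M) : boundedTail γ l M ⊆ boundedTail β n m := by
  rintro α ⟨h1, h2⟩
  refine ⟨fun i hi => (h1 i (by omega)).trans (hγ.1 i hi), fun i hi => ?_⟩
  rcases lt_or_ge i l with h | h
  · rw [h1 i h]; exact hγ.2 i hi
  · exact hM.trans (h2 i h)

theorem exists_boundedTail_dense {G : ℕ → Set (ℕ → ℕ)}
    (hG : {β : ℕ → ℕ | Tendsto β atTop atTop} ⊆ ⋃ i, G i) :
    ∃ i β n m, ∀ γ ∈ boundedTail β n m, ∀ l ≥ n, ∀ M ≥ m, (boundedTail γ l M ∩ G i).Nonempty := by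
  by_contra! hcon
  let S := {s : (ℕ → ℕ) × ℕ × ℕ // s.1 ∈ boundedTail s.1 s.2.1 s.2.2}
  let R : ℕ → S → S → Prop := fun i s s' => s'.1.1 ∈ boundedTail s.1.1 s.1.2.1 s.1.2.2 ∧
    s.1.2.1 < s'.1.2.1 ∧ s.1.2.2 < s'.1.2.2 ∧ boundedTail s'.1.1 s'.1.2.1 s'.1.2.2 ∩ G i = ∅
  have step : ∀ i s, ∃ s', R i s s' := by
    rintro i ⟨⟨β, n, m⟩, hs⟩
    obtain ⟨γ, hγ, l, hl, M, hM, he⟩ := hcon i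
      (fun j => if j ≤ n then β j else max (β j) (m + 1)) (n + 1) (m + 1)
    refine ⟨⟨⟨fun j => if j < l then γ j else M, l, M⟩, ?_⟩, ?_, ?_, ?_, ?_⟩
    · refine ⟨fun j _ => rfl, fun j hj => ?_⟩
      simp only [ge_iff_le] at hj
      simp [not_lt.2 hj]
    · refine ⟨fun j hj => ?_, fun j hj => ?_⟩
      · simp only at hj
        have h1 := hγ.1 j (by omega)
        simp only [hj.le, if_true] at h1
        simp [show j < l by omega, h1]
      · simp only [ge_iff_le] at hj ⊢
        split_ifs with h
        · rcases Nat.lt_or_ge j (n + 1) with h' | h'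
          · have h1 := hγ.1 j h'
            simp only [show j ≤ n by omega, if_true] at h1
            exact h1 ▸ hs.2 j hj
          · exact (Nat.le_succ m).trans (hγ.2 j h')
        · omega
    · simp only; omega
    · simp only; omega
    · rw [← he]
      congr 1
      ext α
      simp only [boundedTail, Set.mem_ofPred_eq]
      refine and_congr_left fun _ => forall₂_congr fun j hj => ?_
      rw [if_pos hj]
  obtain ⟨s, -, hs⟩ := exists_seq_of_forall_exists_rel
    (⟨⟨fun _ => 0, 0, 0⟩, by simp [boundedTail]⟩ : S) R step
  have hl : StrictMono fun k => (s k).1.2.1 := strictMono_nat_of_lt_succ fun k => (hs k).2.1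
  have hm : StrictMono fun k => (s k).1.2.2 := strictMono_nat_of_lt_succ fun k => (hs k).2.2.1
  obtain ⟨β, hβ⟩ := exists_forall_eq_of_coherent hl (γ := fun k => (s k).1.1)
    fun k i hi => (hs k).1.1 i hi
  have hmem : ∀ k d, (s (k + d)).1.1 ∈ boundedTail (s k).1.1 (s k).1.2.1 (s k).1.2.2 := by
    intro k d
    induction d with
    | zero => exact (s k).2
    | succ d ih =>
      exact boundedTail_subset ih (hl.monotone (Nat.le_add_right k d))
        (hm.monotone (Nat.le_add_right k d)) (hs (k + d)).1
  have hβm : ∀ k, β ∈ boundedTail (s k).1.1 (s k).1.2.1 (s k).1.2.2 := by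
    refine fun k => ⟨fun i hi => hβ k i hi, fun i hi => ?_⟩
    rw [hβ (k + (i + 1)) i ((Nat.lt_succ_self i).trans_le
      ((hl.id_le _).trans (hl.monotone (by omega))))]
    exact (hmem k _).2 i hi
  have hβt : Tendsto β atTop atTop := tendsto_atTop_atTop.2 fun b =>
    ⟨(s b).1.2.1, fun i hi => (hm.id_le b).trans ((hβm b).2 i hi)⟩
  obtain ⟨i, hi⟩ := Set.mem_iUnion.1 (hG hβt)
  exact (hs i).2.2.2.subset ⟨hβm (i + 1), hi⟩

/-- The set of sequences of natural numbers that tend to infinity is not `Σ⁰₃`. -/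
theorem not_isSigmaZero_three_tendsto_atTop :
    ¬ IsSigmaZero 3 {β : ℕ → ℕ | Tendsto β atTop atTop} := by
  intro h
  obtain ⟨G, hG, he⟩ := h.exists_isGδ_of_three
  obtain ⟨i, β, n, m, hd⟩ := exists_boundedTail_dense he.subset
  obtain ⟨U, hU, hGU⟩ := (hG i).eq_iInter_nat
  let S := {s : (ℕ → ℕ) × ℕ // s.1 ∈ boundedTail β n m ∧ n ≤ s.2}
  let R : ℕ → S → S → Prop := fun k s s' => (∀ j < s.1.2, s'.1.1 j = s.1.1 j) ∧
    s'.1.1 s.1.2 = m ∧ s.1.2 < s'.1.2 ∧ PiNat.cylinder s'.1.1 s'.1.2 ⊆ U k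
  have step : ∀ k s, ∃ s', R k s s' := by
    rintro k ⟨⟨γ, l⟩, hγ, hl⟩
    simp only at hγ hl
    have hγ' : Function.update γ l m ∈ boundedTail β n m := by
      refine ⟨fun j hj => ?_, fun j hj => ?_⟩
      · rw [Function.update_of_ne (by omega)]; exact hγ.1 j hj
      · rcases eq_or_ne j l with rfl | hne
        · simp
        · rw [Function.update_of_ne hne]; exact hγ.2 j hj
    obtain ⟨α, hα, hαG⟩ := hd _ hγ' (l + 1) (by omega) m le_rfl
    have hαU : α ∈ U k := by rw [hGU] at hαG; exact Set.mem_iInter.1 hαG k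
    obtain ⟨_, ⟨x, p, rfl⟩, hx, hxU⟩ :=
      (PiNat.isTopologicalBasis_cylinders (fun _ : ℕ => ℕ)).exists_subset_of_mem_open hαU (hU k)
    refine ⟨⟨⟨α, max p (l + 1)⟩, boundedTail_subset hγ' (by omega) le_rfl hα, by simp; omega⟩,
      fun j hj => ?_, ?_, by simp, ?_⟩
    · simp only at hj ⊢
      rw [hα.1 j (by omega), Function.update_of_ne (by omega)]
    · simp only
      rw [hα.1 l (by omega), Function.update_self]
    · refine (PiNat.cylinder_anti _ (le_max_left _ _)).trans ?_
      rwa [PiNat.mem_cylinder_iff_eq.1 hx]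
  obtain ⟨s, -, hs⟩ := exists_seq_of_forall_exists_rel
    (⟨⟨fun j => if j < n then β j else m, n⟩, ⟨fun j hj => by simp [hj], fun j hj => by
      simp [not_lt.2 hj]⟩, le_rfl⟩ : S) R step
  have hl : StrictMono fun k => (s k).1.2 := strictMono_nat_of_lt_succ fun k => (hs k).2.2.1
  obtain ⟨ξ, hξ⟩ := exists_forall_eq_of_coherent hl (γ := fun k => (s k).1.1) fun k => (hs k).1
  have hξG : ξ ∈ G i := by
    rw [hGU]
    exact Set.mem_iInter.2 fun k => (hs k).2.2.2 (PiNat.mem_cylinder_iff.2 (hξ (k + 1)))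
  have hξt : Tendsto ξ atTop atTop := he.superset (Set.mem_iUnion.2 ⟨i, hξG⟩)
  obtain ⟨N, hN⟩ := eventually_atTop.1 (hξt.eventually_gt_atTop m)
  have h1 := hN (s N).1.2 (hl.id_le N)
  rw [hξ (N + 1) _ (hs N).2.2.1, (hs N).2.1] at h1
  exact lt_irrefl _ h1

/-! # A strong law of large numbers for counts of events -/

section

open MeasureTheory

theorem ae_tendsto_zero_of_summable {Ω : Type*} [MeasurableSpace Ω] {μ : Measure Ω}
    {f : ℕ → Ω → ℝ} {b : ℕ → ℝ} (hf0 : ∀ m ω, 0 ≤ f m ω) (hf : ∀ m, Integrable (f m) μ)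
    (hb : ∀ m, ∫ ω, f m ω ∂μ ≤ b m) (hs : Summable b) :
    ∀ᵐ ω ∂μ, Tendsto (fun m => f m ω) atTop (𝓝 0) := by
  have hle : ∀ m, ∫⁻ ω, ENNReal.ofReal (f m ω) ∂μ ≤ ENNReal.ofReal (b m) := fun m => by
    rw [← ofReal_integral_eq_lintegral_ofReal (hf m) (ae_of_all _ (hf0 m))]
    exact ENNReal.ofReal_le_ofReal (hb m)
  have hfin : ∫⁻ ω, ∑' m, ENNReal.ofReal (f m ω) ∂μ ≠ ⊤ := by
    rw [lintegral_tsum fun m => (hf m).aestronglyMeasurable.aemeasurable.ennreal_ofReal]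
    exact ne_top_of_le_ne_top hs.tsum_ofReal_ne_top (ENNReal.tsum_le_tsum hle)
  have hmeas : AEMeasurable (fun ω => ∑' m, ENNReal.ofReal (f m ω)) μ :=
    AEMeasurable.tsum fun m => (hf m).aestronglyMeasurable.aemeasurable.ennreal_ofReal
  filter_upwards [ae_lt_top' hmeas hfin] with ω hω
  have h1 := ENNReal.tendsto_atTop_zero_of_tsum_ne_top hω.ne
  have h2 := (ENNReal.tendsto_toReal ENNReal.zero_ne_top).comp h1
  simpa [Function.comp_def, ENNReal.toReal_ofReal (hf0 _ _)] using h2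

theorem integral_sq_sum_indicator_sub_le {Ω : Type*} [MeasurableSpace Ω] (μ : Measure Ω)
    [IsProbabilityMeasure μ] {A : ℕ → Set Ω} (hA : ∀ j, MeasurableSet (A j)) {k : ℕ}
    (hind : ∀ i j, i + k ≤ j → μ.real (A i ∩ A j) = μ.real (A i) * μ.real (A j)) (n : ℕ) :
    ∫ ω, (∑ j ∈ Finset.range n, (A j).indicator (1 : Ω → ℝ) ω -
      ∑ j ∈ Finset.range n, μ.real (A j)) ^ 2 ∂μ ≤ 2 * k * ∑ j ∈ Finset.range n, μ.real (A j) := by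
  have hint : ∀ s : Set Ω, MeasurableSet s → Integrable (s.indicator (1 : Ω → ℝ)) μ :=
    fun s hs => (integrable_const (1 : ℝ)).indicator hs
  have hmul : ∀ i j ω, (A i).indicator (1 : Ω → ℝ) ω * (A j).indicator (1 : Ω → ℝ) ω =
      (A i ∩ A j).indicator (1 : Ω → ℝ) ω := fun i j ω => by
    rw [Set.inter_indicator_one]; rfl
  have hexp : ∀ i j ω, ((A i).indicator (1 : Ω → ℝ) ω - μ.real (A i)) *
      ((A j).indicator (1 : Ω → ℝ) ω - μ.real (A j)) = (A i ∩ A j).indicator (1 : Ω → ℝ) ω -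
      μ.real (A j) * (A i).indicator (1 : Ω → ℝ) ω - μ.real (A i) * (A j).indicator (1 : Ω → ℝ) ω
      + μ.real (A i) * μ.real (A j) := fun i j ω => by rw [← hmul]; ring
  have hcint : ∀ i j, Integrable (fun ω => ((A i).indicator (1 : Ω → ℝ) ω - μ.real (A i)) *
      ((A j).indicator (1 : Ω → ℝ) ω - μ.real (A j))) μ := fun i j => by
    simp_rw [hexp]
    exact (((hint _ ((hA i).inter (hA j))).sub ((hint _ (hA i)).const_mul _)).sub
      ((hint _ (hA j)).const_mul _)).add (integrable_const _)
  have hcov : ∀ i j, ∫ ω, ((A i).indicator (1 : Ω → ℝ) ω - μ.real (A i)) *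
      ((A j).indicator (1 : Ω → ℝ) ω - μ.real (A j)) ∂μ =
      μ.real (A i ∩ A j) - μ.real (A i) * μ.real (A j) := fun i j => by
    simp_rw [hexp]
    have i1 : Integrable (fun ω => (A i ∩ A j).indicator (1 : Ω → ℝ) ω) μ :=
      hint _ ((hA i).inter (hA j))
    have i2 : Integrable (fun ω => μ.real (A j) * (A i).indicator (1 : Ω → ℝ) ω) μ :=
      (hint _ (hA i)).const_mul _
    have i3 : Integrable (fun ω => μ.real (A i) * (A j).indicator (1 : Ω → ℝ) ω) μ :=
      (hint _ (hA j)).const_mul _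
    have i4 : Integrable (fun ω => (A i ∩ A j).indicator (1 : Ω → ℝ) ω -
      μ.real (A j) * (A i).indicator (1 : Ω → ℝ) ω) μ := i1.sub i2
    have i5 : Integrable (fun ω => (A i ∩ A j).indicator (1 : Ω → ℝ) ω -
      μ.real (A j) * (A i).indicator (1 : Ω → ℝ) ω -
      μ.real (A i) * (A j).indicator (1 : Ω → ℝ) ω) μ := i4.sub i3
    rw [integral_add i5 (integrable_const _), integral_sub i4 i3, integral_sub i1 i2,
      integral_const_mul, integral_const_mul, integral_indicator_one (hA i),
      integral_indicator_one (hA j), integral_indicator_one ((hA i).inter (hA j))]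
    simp
    ring
  have hbound : ∀ i j, μ.real (A i ∩ A j) - μ.real (A i) * μ.real (A j) ≤
      if j ∈ Finset.Ico (i - k) (i + k) then μ.real (A i) else 0 := by
    intro i j
    split_ifs with h
    · have h1 : μ.real (A i ∩ A j) ≤ μ.real (A i) := measureReal_mono Set.inter_subset_left
      have h2 : 0 ≤ μ.real (A i) * μ.real (A j) := by positivity
      linarith
    · rw [Finset.mem_Ico, not_and_or, not_le, not_lt] at h
      rcases h with h | h
      · rw [Set.inter_comm, hind j i (by omega)]
        linarith
      · rw [hind i j h]
        linarith
  simp_rw [← Finset.sum_sub_distrib, sq, Finset.sum_mul_sum]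
  rw [integral_finsetSum _ fun i _ => integrable_finsetSum _ fun j _ => hcint i j, Finset.mul_sum]
  refine Finset.sum_le_sum fun i _ => ?_
  rw [integral_finsetSum _ fun j _ => hcint i j]
  simp_rw [hcov]
  refine (Finset.sum_le_sum fun j _ => hbound i j).trans ?_
  rw [← Finset.sum_filter, Finset.sum_const, nsmul_eq_mul]
  refine mul_le_mul_of_nonneg_right ?_ measureReal_nonneg
  have h1 : (Finset.filter (fun j => j ∈ Finset.Ico (i - k) (i + k)) (Finset.range n)).card
      ≤ 2 * k := by
    refine (Finset.card_le_card (t := Finset.Ico (i - k) (i + k)) fun j hj =>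
      (Finset.mem_filter.1 hj).2).trans ?_
    rw [Nat.card_Ico]
    omega
  exact_mod_cast h1

end

/-- If the monotone `S` is asymptotic to the monotone `E` along the sequence of the first indices
where `E` reaches the squares, then it is asymptotic to `E`. -/
theorem tendsto_div_one_of_tendsto_squares {S E : ℕ → ℝ} (hS0 : ∀ n, 0 ≤ S n) (hS : Monotone S)
    (hE : Tendsto E atTop atTop) {n : ℕ → ℕ}
    (hn : ∀ m j, n m ≤ j ↔ (m : ℝ) ^ 2 ≤ E j)
    (h : Tendsto (fun m => S (n m) / (m : ℝ) ^ 2) atTop (𝓝 1)) :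
    Tendsto (fun j => S j / E j) atTop (𝓝 1) := by
  set r : ℕ → ℕ := fun j => ⌊Real.sqrt (E j)⌋₊ with hr
  have hrt : Tendsto r atTop atTop :=
    tendsto_nat_floor_atTop.comp (Real.tendsto_sqrt_atTop.comp hE)
  have hq : Tendsto (fun m : ℕ => ((m : ℝ) / ((m : ℝ) + 1)) ^ 2) atTop (𝓝 1) := by
    simpa using (tendsto_natCast_div_add_atTop (1 : ℝ)).pow 2
  have hlo : Tendsto (fun m : ℕ => S (n m) / ((m : ℝ) + 1) ^ 2) atTop (𝓝 1) := by
    have h1 := h.mul hq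
    rw [mul_one] at h1
    refine h1.congr' ?_
    filter_upwards [eventually_gt_atTop 0] with m hm
    have : (0 : ℝ) < m := by exact_mod_cast hm
    field_simp
  have hhi : Tendsto (fun m : ℕ => S (n (m + 1)) / (m : ℝ) ^ 2) atTop (𝓝 1) := by
    have h1 := (h.comp (tendsto_add_atTop_nat 1)).div hq one_ne_zero
    rw [div_one] at h1
    refine h1.congr' ?_
    filter_upwards [eventually_gt_atTop 0] with m hm
    have : (0 : ℝ) < m := by exact_mod_cast hm
    simp only [Function.comp, Nat.cast_add, Nat.cast_one, Pi.div_apply]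
    field_simp
  have hsq : ∀ᶠ j in atTop, 0 < r j ∧ (r j : ℝ) ^ 2 ≤ E j ∧ E j < ((r j : ℝ) + 1) ^ 2 := by
    filter_upwards [hE.eventually_ge_atTop 0, hrt.eventually_gt_atTop 0] with j hj hr0
    refine ⟨hr0, ?_, ?_⟩
    · have := Nat.floor_le (Real.sqrt_nonneg (E j))
      calc (r j : ℝ) ^ 2 ≤ Real.sqrt (E j) ^ 2 := by gcongr
        _ = E j := Real.sq_sqrt hj
    · have := Nat.lt_floor_add_one (Real.sqrt (E j))
      calc E j = Real.sqrt (E j) ^ 2 := (Real.sq_sqrt hj).symm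
        _ < ((r j : ℝ) + 1) ^ 2 := by gcongr
  refine tendsto_of_tendsto_of_tendsto_of_le_of_le' (hlo.comp hrt) (hhi.comp hrt) ?_ ?_
  · filter_upwards [hsq] with j hj
    have h0 : (0 : ℝ) < r j := by exact_mod_cast hj.1
    have h1 : S (n (r j)) ≤ S j := hS ((hn _ _).2 hj.2.1)
    have h2 : 0 < E j := lt_of_lt_of_le (by positivity) hj.2.1
    exact div_le_div₀ (hS0 _) h1 h2 hj.2.2.le
  · filter_upwards [hsq] with j hj
    have h0 : (0 : ℝ) < r j := by exact_mod_cast hj.1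
    have h1 : j ≤ n (r j + 1) := by
      refine le_of_lt (not_le.1 fun h => ?_)
      have := (hn _ _).1 h
      push_cast at this
      linarith [hj.2.2]
    exact div_le_div₀ (hS0 _) (hS h1) (by positivity) hj.2.1

section

open MeasureTheory

/-- The strong law of large numbers for counts of events that are pairwise independent at distance
at least `k`. -/
theorem ae_tendsto_sum_indicator_div {Ω : Type*} [MeasurableSpace Ω] (μ : Measure Ω)
    [IsProbabilityMeasure μ] {A : ℕ → Set Ω} (hA : ∀ j, MeasurableSet (A j)) {k : ℕ}
    (hind : ∀ i j, i + k ≤ j → μ.real (A i ∩ A j) = μ.real (A i) * μ.real (A j))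
    (hE : Tendsto (fun n => ∑ j ∈ Finset.range n, μ.real (A j)) atTop atTop) :
    ∀ᵐ ω ∂μ, Tendsto (fun n => (∑ j ∈ Finset.range n, (A j).indicator (1 : Ω → ℝ) ω) /
      ∑ j ∈ Finset.range n, μ.real (A j)) atTop (𝓝 1) := by
  set E : ℕ → ℝ := fun n => ∑ j ∈ Finset.range n, μ.real (A j) with hEdef
  set S : Ω → ℕ → ℝ := fun ω n => ∑ j ∈ Finset.range n, (A j).indicator (1 : Ω → ℝ) ω with hSdef
  have hX0 : ∀ j ω, 0 ≤ (A j).indicator (1 : Ω → ℝ) ω := fun j ω =>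
    Set.indicator_nonneg (fun _ _ => zero_le_one) _
  have hEs : ∀ n, E (n + 1) = E n + μ.real (A n) := fun n => Finset.sum_range_succ _ _
  have hEm : Monotone E := monotone_nat_of_le_succ fun n => by
    rw [hEs]; linarith [measureReal_nonneg (μ := μ) (s := A n)]
  have hE1 : ∀ n, E (n + 1) ≤ E n + 1 := fun n => by
    rw [hEs]; linarith [measureReal_le_one (μ := μ) (s := A n)]
  have hex : ∀ m : ℕ, ∃ j, (m : ℝ) ^ 2 ≤ E j := fun m =>
    (hE.eventually_ge_atTop _).exists
  classical
  set n : ℕ → ℕ := fun m => Nat.find (hex m) with hndef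
  have hn : ∀ m j, n m ≤ j ↔ (m : ℝ) ^ 2 ≤ E j := fun m j =>
    ⟨fun h => (Nat.find_spec (hex m)).trans (hEm h), fun h => Nat.find_min' _ h⟩
  have hnE : ∀ m, E (n m) ≤ (m : ℝ) ^ 2 + 1 := by
    intro m
    rcases Nat.eq_zero_or_pos (n m) with h | h
    · rw [h, hEdef]; simp only [Finset.range_zero, Finset.sum_empty]; positivity
    · have h1 : ¬ (m : ℝ) ^ 2 ≤ E (n m - 1) := fun hc => by
        have := (hn _ _).2 hc
        omega
      have h2 := hE1 (n m - 1)
      rw [Nat.sub_add_cancel h] at h2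
      linarith [not_le.1 h1]
  have hSm : ∀ n, Measurable fun ω => S ω n := fun n =>
    Finset.measurable_sum _ fun j _ => measurable_one.indicator (hA j)
  have hSb : ∀ n ω, |S ω n| ≤ n := by
    intro n ω
    rw [abs_of_nonneg (Finset.sum_nonneg fun j _ => hX0 j ω)]
    calc S ω n ≤ ∑ j ∈ Finset.range n, (1 : ℝ) :=
          Finset.sum_le_sum fun j _ => Set.indicator_le_self' (fun _ _ => zero_le_one) _
      _ = n := by simp
  have hint : ∀ n, Integrable (fun ω => (S ω n - E n) ^ 2) μ := by
    intro n
    refine Integrable.of_bound (((hSm n).sub_const _).pow_const 2).aestronglyMeasurable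
      ((n + |E n|) ^ 2) (ae_of_all _ fun ω => ?_)
    rw [norm_pow, Real.norm_eq_abs]
    have h1 : |S ω n - E n| ≤ n + |E n| := (abs_sub _ _).trans (by linarith [hSb n ω])
    gcongr
  have key := ae_tendsto_zero_of_summable (μ := μ)
    (f := fun m ω => (S ω (n m) - E (n m)) ^ 2 / (m : ℝ) ^ 4)
    (b := fun m => 4 * k * (1 / (m : ℝ) ^ 2)) (fun m ω => by positivity)
    (fun m => (hint _).div_const _) (fun m => ?_)
    ((Real.summable_one_div_nat_pow.2 (by norm_num)).mul_left _)
  · filter_upwards [key] with ω hω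
    refine tendsto_div_one_of_tendsto_squares (fun j => Finset.sum_nonneg fun j _ => hX0 j ω)
      (monotone_nat_of_le_succ fun j => ?_) hE hn ?_
    · change S ω j ≤ S ω (j + 1)
      simp only [hSdef, Finset.sum_range_succ]
      linarith [hX0 j ω]
    · have h1 : Tendsto (fun m => (S ω (n m) - E (n m)) / (m : ℝ) ^ 2) atTop (𝓝 0) := by
        have h2 := (Real.continuous_sqrt.tendsto 0).comp hω
        rw [Real.sqrt_zero] at h2
        refine (tendsto_zero_iff_abs_tendsto_zero _).2 (h2.congr fun m => ?_)
        rw [Function.comp_apply, Function.comp_apply, ← Real.sqrt_sq_eq_abs]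
        congr 1
        rw [div_pow]; ring
      have h3 : Tendsto (fun m => E (n m) / (m : ℝ) ^ 2) atTop (𝓝 1) := by
        have h4 : Tendsto (fun m : ℕ => 1 + 1 / (m : ℝ) ^ 2) atTop (𝓝 1) := by
          have : Tendsto (fun m : ℕ => 1 / (m : ℝ) ^ 2) atTop (𝓝 0) := by
            simpa using (tendsto_one_div_atTop_nhds_zero_nat (𝕜 := ℝ)).pow 2
          simpa using this.const_add 1
        refine tendsto_of_tendsto_of_tendsto_of_le_of_le' tendsto_const_nhds h4 ?_ ?_
        · filter_upwards [eventually_gt_atTop 0] with m hm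
          have : (0 : ℝ) < m := by exact_mod_cast hm
          rw [le_div_iff₀ (by positivity), one_mul]
          exact (hn m _).1 le_rfl
        · filter_upwards [eventually_gt_atTop 0] with m hm
          have : (0 : ℝ) < m := by exact_mod_cast hm
          rw [div_le_iff₀ (by positivity), add_mul, one_mul, one_div_mul_cancel (by positivity)]
          exact hnE m
      have h5 := h1.add h3
      rw [zero_add] at h5
      refine h5.congr fun m => ?_
      rw [← add_div, sub_add_cancel]
  · rw [integral_div]
    rcases Nat.eq_zero_or_pos m with rfl | hm
    · simp
    · have hm' : (1 : ℝ) ≤ m := by exact_mod_cast hm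
      rw [div_le_iff₀ (by positivity)]
      refine (integral_sq_sum_indicator_sub_le μ hA hind (n m)).trans ?_
      have h1 : (4 : ℝ) * k * (1 / (m : ℝ) ^ 2) * (m : ℝ) ^ 4 = 2 * k * (2 * (m : ℝ) ^ 2) := by
        field_simp; ring
      rw [h1]
      refine mul_le_mul_of_nonneg_left ((hnE m).trans ?_) (by positivity)
      nlinarith

end

/-! # Digit sequences with prescribed digit weights -/

/-- The number of occurrences of `B` in the sequence `a` with a start in the first `n` positions. -/
def digitCount (a : ℕ → ℕ) (B : List ℕ) (n : ℕ) : ℕ :=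
  ((Finset.range n).filter fun i => ∀ t : Fin B.length, a (i + t) = B.get t).card

/-- The expected number of occurrences of `B` with a start in the first `n` positions in a sequence
of independent digits, the digit in position `j` being `d` with probability `w j d`. -/
def weightedCount (w : ℕ → ℕ → ℝ) (B : List ℕ) (n : ℕ) : ℝ :=
  ∑ j ∈ Finset.range n, ∏ t : Fin B.length, w (j + t) (B.get t)

section

open MeasureTheory

/-- The law of a digit below `q` with the given weights. -/
noncomputable def digitPMF (w : ℕ → ℝ) (q : ℕ) (hw0 : ∀ d, 0 ≤ w d) (hw : ∀ d, q ≤ d → w d = 0)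
    (hsum : ∑ d ∈ Finset.range q, w d = 1) : PMF ℕ :=
  PMF.ofFinset (fun d => ENNReal.ofReal (w d)) (Finset.range q)
    (by rw [← ENNReal.ofReal_sum_of_nonneg fun d _ => hw0 d, hsum, ENNReal.ofReal_one])
    (fun d hd => by rw [hw d (by simpa using hd), ENNReal.ofReal_zero])

theorem exists_digits_tendsto_digitCount_div {Q : ℕ → ℕ} (w : ℕ → ℕ → ℝ) (hw0 : ∀ j d, 0 ≤ w j d)
    (hw : ∀ j d, Q j ≤ d → w j d = 0) (hsum : ∀ j, ∑ d ∈ Finset.range (Q j), w j d = 1) :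
    ∃ a : ℕ → ℕ, (∀ j, a j < Q j) ∧ ∀ B, Tendsto (weightedCount w B) atTop atTop →
      Tendsto (fun n => (digitCount a B n : ℝ) / weightedCount w B n) atTop (𝓝 1) := by
  set p : ℕ → PMF ℕ := fun j => digitPMF (w j) (Q j) (hw0 j) (hw j) (hsum j) with hp
  set μ : Measure (ℕ → ℕ) := Measure.infinitePi fun j => (p j).toMeasure with hμ
  have hpi : ∀ (s : Finset ℕ) (u : ℕ → ℕ),
      μ.real (Set.pi s fun i => {u i}) = ∏ i ∈ s, w i (u i) := by
    intro s u
    rw [Measure.real, hμ, Measure.infinitePi_pi _ (fun i _ => measurableSet_singleton _),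
      ENNReal.toReal_prod]
    refine Finset.prod_congr rfl fun i _ => ?_
    rw [PMF.toMeasure_apply_singleton _ _ (measurableSet_singleton _)]
    exact ENNReal.toReal_ofReal (hw0 _ _)
  have hlt : ∀ᵐ ω ∂μ, ∀ j, ω j < Q j := by
    have h1 : ∀ᵐ ω ∂μ, ∀ j d, Q j ≤ d → ω j ≠ d := by
      refine ae_all_iff.2 fun j => ae_all_iff.2 fun d => ?_
      by_cases hd : Q j ≤ d
      swap
      · exact ae_of_all _ fun ω h => absurd h hd
      have h2 := hpi {j} fun _ => d
      rw [Finset.prod_singleton, hw j d hd, measureReal_eq_zero_iff] at h2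
      filter_upwards [compl_mem_ae_iff.2 h2] with ω hω _ he
      exact hω (by simpa using he)
    filter_upwards [h1] with ω hω j
    exact not_le.1 fun h => hω j _ h rfl
  have hB : ∀ᵐ ω ∂μ, ∀ B, Tendsto (weightedCount w B) atTop atTop →
      Tendsto (fun n => (digitCount ω B n : ℝ) / weightedCount w B n) atTop (𝓝 1) := by
    refine ae_all_iff.2 fun B => ?_
    by_cases hinf : Tendsto (weightedCount w B) atTop atTop
    swap
    · exact ae_of_all _ fun ω h => absurd h hinf
    set A : ℕ → Set (ℕ → ℕ) := fun j => {ω | ∀ t : Fin B.length, ω (j + t) = B.get t} with hAdef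
    have hAmeas : ∀ j, MeasurableSet (A j) := fun j => by
      have : A j = ⋂ t : Fin B.length, {ω | ω (j + t) = B.get t} := by
        ext ω; simp [hAdef]
      rw [this]
      exact MeasurableSet.iInter fun t =>
        measurableSet_eq_fun (measurable_pi_apply (j + (t : ℕ))) measurable_const
    have hApi : ∀ j (u : ℕ → ℕ), (∀ t : Fin B.length, u (j + t) = B.get t) →
        A j = Set.pi (Finset.Ico j (j + B.length)) fun i => {u i} := by
      intro j u hu
      ext ω
      simp only [hAdef, Set.mem_ofPred_eq, Set.mem_pi, Finset.coe_Ico, Set.mem_Ico,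
        Set.mem_singleton_iff]
      constructor
      · rintro h i ⟨h1, h2⟩
        have h3 := (h ⟨i - j, by omega⟩).trans (hu ⟨i - j, by omega⟩).symm
        simpa [Nat.add_sub_cancel' h1] using h3
      · intro h t
        rw [← hu t]
        exact h _ ⟨by omega, by omega⟩
    have hex : ∀ j, ∀ t : Fin B.length, B.getD (j + t - j) 0 = B.get t := fun j t => by simp
    have hAp : ∀ j, μ.real (A j) = ∏ t : Fin B.length, w (j + t) (B.get t) := by
      intro j
      rw [hApi j (fun i => B.getD (i - j) 0) (hex j), hpi, Finset.prod_Ico_eq_prod_range,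
        Nat.add_sub_cancel_left, Finset.prod_range]
      exact Finset.prod_congr rfl fun t _ => by rw [hex j t]
    have hind : ∀ i j, i + B.length ≤ j →
        μ.real (A i ∩ A j) = μ.real (A i) * μ.real (A j) := by
      intro i j hij
      set u : ℕ → ℕ := fun l => if l < j then B.getD (l - i) 0 else B.getD (l - j) 0 with hu
      have hi : ∀ t : Fin B.length, u (i + t) = B.get t := fun t => by
        simp only [hu]
        rw [if_pos (by omega)]
        exact hex i t
      have hj : ∀ t : Fin B.length, u (j + t) = B.get t := fun t => by
        simp only [hu]
        rw [if_neg (by omega)]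
        exact hex j t
      have hdisj : Disjoint (Finset.Ico i (i + B.length)) (Finset.Ico j (j + B.length)) :=
        Finset.disjoint_left.2 fun l h1 h2 => by
          rw [Finset.mem_Ico] at h1 h2; omega
      rw [hApi i u hi, hApi j u hj, ← Set.union_pi, ← Finset.coe_union, hpi, hpi, hpi,
        Finset.prod_union hdisj]
    have hEe : (fun n => ∑ j ∈ Finset.range n, μ.real (A j)) = weightedCount w B := by
      funext n
      exact Finset.sum_congr rfl fun j _ => hAp j
    filter_upwards [ae_tendsto_sum_indicator_div μ hAmeas hind (by rwa [hEe])] with ω hω _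
    refine hω.congr fun n => ?_
    congr 1
    · simp only [digitCount, Finset.card_filter, Nat.cast_sum, Set.indicator_apply, hAdef,
        Set.mem_ofPred_eq, Nat.cast_ite, Nat.cast_one, Nat.cast_zero, Pi.one_apply]
    · exact congrFun hEe n
  exact (hlt.and hB).exists

end

/-! # Biased digits -/

/-- A digit next to `d`, available in every base in which `d` is. -/
def neighborDigit (d : ℕ) : ℕ := if d = 0 then 1 else d - 1

theorem neighborDigit_ne (d : ℕ) : neighborDigit d ≠ d := by
  unfold neighborDigit; split_ifs <;> omega

theorem neighborDigit_lt {d q : ℕ} (hq : 2 ≤ q) (hd : d < q) : neighborDigit d < q := by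
  unfold neighborDigit; split_ifs <;> omega

theorem abs_sub_neighborDigit_le (d : ℕ) : |(d : ℤ) - neighborDigit d| ≤ 1 := by
  unfold neighborDigit
  split_ifs with h
  · simp [h]
  · rw [Nat.cast_sub (by omega)]; simp

/-- The density with respect to the uniform law on the digits below `q` of the law that moves the
proportion `δ` of the mass of `d` to its neighbor. -/
noncomputable def biasDensity (q d : ℕ) (δ : ℝ) (e : ℕ) : ℝ :=
  if d < q then 1 - (if e = d then δ else 0) + (if e = neighborDigit d then δ else 0) else 1

noncomputable def biasedWeight (Q : ℕ → ℕ) (d : ℕ) (δ : ℝ) (j e : ℕ) : ℝ :=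
  if e < Q j then biasDensity (Q j) d δ e / Q j else 0

theorem le_biasDensity {δ : ℝ} (hδ : 0 ≤ δ) (q d e : ℕ) : 1 - δ ≤ biasDensity q d δ e := by
  unfold biasDensity; split_ifs <;> linarith

theorem biasDensity_le {δ : ℝ} (hδ : 0 ≤ δ) (q d e : ℕ) : biasDensity q d δ e ≤ 1 + δ := by
  unfold biasDensity; split_ifs <;> linarith

theorem biasedWeight_nonneg {δ : ℝ} (hδ : 0 ≤ δ) (hδ1 : δ ≤ 1) (Q : ℕ → ℕ) (d j e : ℕ) :
    0 ≤ biasedWeight Q d δ j e := by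
  unfold biasedWeight
  split_ifs
  · exact div_nonneg (by linarith [le_biasDensity hδ (Q j) d e]) (by positivity)
  · exact le_rfl

theorem sum_biasedWeight {Q : ℕ → ℕ} (hQ : IsBasicSequence Q) (d : ℕ) (δ : ℝ) (j : ℕ) :
    ∑ e ∈ Finset.range (Q j), biasedWeight Q d δ j e = 1 := by
  have hq : (Q j : ℝ) ≠ 0 := by have := hQ j; positivity
  have h1 : ∀ e ∈ Finset.range (Q j), biasedWeight Q d δ j e = biasDensity (Q j) d δ e / Q j :=
    fun e he => if_pos (Finset.mem_range.1 he)
  rw [Finset.sum_congr rfl h1, ← Finset.sum_div, div_eq_one_iff_eq hq]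
  unfold biasDensity
  split_ifs with hd
  · rw [Finset.sum_add_distrib, Finset.sum_sub_distrib, Finset.sum_ite_eq', Finset.sum_ite_eq',
      if_pos (Finset.mem_range.2 hd), if_pos (Finset.mem_range.2 (neighborDigit_lt (hQ j) hd))]
    simp
  · simp

/-- The probability that `B` occurs in position `j`, for uniform digits. -/
noncomputable def occurrenceProb (Q : ℕ → ℕ) (B : List ℕ) (j : ℕ) : ℝ :=
  (if ∀ t : Fin B.length, B.get t < Q (j + t) then (1 : ℝ) else 0) /
    ∏ t ∈ Finset.range B.length, (Q (j + t) : ℝ)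

theorem occurrenceProb_nonneg (Q : ℕ → ℕ) (B : List ℕ) (j : ℕ) : 0 ≤ occurrenceProb Q B j := by
  unfold occurrenceProb
  split_ifs <;> positivity

theorem expectedCount_eq_sum (Q : ℕ → ℕ) (B : List ℕ) (n : ℕ) :
    expectedCount Q B n = ∑ j ∈ Finset.range n, occurrenceProb Q B j := rfl

theorem expectedCount_nonneg (Q : ℕ → ℕ) (B : List ℕ) (n : ℕ) : 0 ≤ expectedCount Q B n :=
  Finset.sum_nonneg fun j _ => occurrenceProb_nonneg Q B j

theorem expectedCount_mono (Q : ℕ → ℕ) (B : List ℕ) : Monotone (expectedCount Q B) :=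
  fun _ _ h => Finset.sum_le_sum_of_subset_of_nonneg (Finset.range_mono h)
    fun j _ _ => occurrenceProb_nonneg Q B j

theorem prod_biasedWeight (Q : ℕ → ℕ) (d : ℕ) (δ : ℝ) (B : List ℕ) (j : ℕ) :
    ∏ t : Fin B.length, biasedWeight Q d δ (j + t) (B.get t) =
      (∏ t : Fin B.length, biasDensity (Q (j + t)) d δ (B.get t)) * occurrenceProb Q B j := by
  unfold biasedWeight occurrenceProb
  rw [Finset.prod_ite_zero, Finset.prod_range]
  simp only [Finset.mem_univ, true_imp_iff]
  split_ifs
  · rw [Finset.prod_div_distrib, mul_one_div]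
  · simp

theorem weightedCount_biasedWeight (Q : ℕ → ℕ) (d : ℕ) (δ : ℝ) (B : List ℕ) (n : ℕ) :
    weightedCount (biasedWeight Q d δ) B n = ∑ j ∈ Finset.range n,
      (∏ t : Fin B.length, biasDensity (Q (j + t)) d δ (B.get t)) * occurrenceProb Q B j :=
  Finset.sum_congr rfl fun j _ => prod_biasedWeight Q d δ B j

theorem le_weightedCount {δ : ℝ} (hδ : 0 ≤ δ) (hδ1 : δ ≤ 1) (Q : ℕ → ℕ) (d : ℕ) (B : List ℕ)
    (n : ℕ) : (1 - δ) ^ B.length * expectedCount Q B n ≤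
      weightedCount (biasedWeight Q d δ) B n := by
  rw [weightedCount_biasedWeight, expectedCount_eq_sum, Finset.mul_sum]
  refine Finset.sum_le_sum fun j _ =>
    mul_le_mul_of_nonneg_right ?_ (occurrenceProb_nonneg Q B j)
  calc (1 - δ) ^ B.length = ∏ t : Fin B.length, (1 - δ) := by simp
    _ ≤ _ := Finset.prod_le_prod (fun _ _ => by linarith) fun t _ => le_biasDensity hδ _ _ _

theorem weightedCount_le {δ : ℝ} (hδ : 0 ≤ δ) (hδ1 : δ ≤ 1) (Q : ℕ → ℕ) (d : ℕ) (B : List ℕ)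
    (n : ℕ) : weightedCount (biasedWeight Q d δ) B n ≤
      (1 + δ) ^ B.length * expectedCount Q B n := by
  rw [weightedCount_biasedWeight, expectedCount_eq_sum, Finset.mul_sum]
  refine Finset.sum_le_sum fun j _ =>
    mul_le_mul_of_nonneg_right ?_ (occurrenceProb_nonneg Q B j)
  calc _ ≤ ∏ t : Fin B.length, (1 + δ) :=
        Finset.prod_le_prod (fun t _ => by
          linarith [le_biasDensity hδ (Q (j + t)) d (B.get t)]) fun t _ => biasDensity_le hδ _ _ _
    _ = (1 + δ) ^ B.length := by simp

theorem weightedCount_eq_expectedCount (Q : ℕ → ℕ) {d : ℕ} (δ : ℝ) {B : List ℕ} (hd : d ∉ B)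
    (hd' : neighborDigit d ∉ B) (n : ℕ) :
    weightedCount (biasedWeight Q d δ) B n = expectedCount Q B n := by
  rw [weightedCount_biasedWeight, expectedCount_eq_sum]
  refine Finset.sum_congr rfl fun j _ => ?_
  rw [Finset.prod_eq_one, one_mul]
  intro t _
  have h1 : B.get t ≠ d := fun h => hd (h ▸ List.get_mem _ _)
  have h2 : B.get t ≠ neighborDigit d := fun h => hd' (h ▸ List.get_mem _ _)
  simp only [biasDensity, if_neg h1, if_neg h2]
  simp

/-- The number of entries of `B`, placed in position `j`, that the bias favors. -/
def favoredCount (Q : ℕ → ℕ) (d : ℕ) (B : List ℕ) (j : ℕ) : ℕ :=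
  (Finset.univ.filter fun t : Fin B.length =>
    B.get t = neighborDigit d ∧ d < Q (j + t)).card

theorem favoredCount_le (Q : ℕ → ℕ) (d : ℕ) (B : List ℕ) (j : ℕ) :
    favoredCount Q d B j ≤ B.length :=
  (Finset.card_le_univ _).trans (by simp)

theorem prod_biasDensity_mul (Q : ℕ → ℕ) (d : ℕ) (δ : ℝ) (B : List ℕ) (j : ℕ) :
    (∏ t : Fin B.length, biasDensity (Q (j + t)) d δ (B.get t)) * occurrenceProb Q B j =
      (1 - δ) ^ (Finset.univ.filter fun t : Fin B.length => B.get t = d).card *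
        (1 + δ) ^ favoredCount Q d B j * occurrenceProb Q B j := by
  by_cases h : ∀ t : Fin B.length, B.get t < Q (j + t)
  · congr 1
    have h1 : ∀ t : Fin B.length, biasDensity (Q (j + t)) d δ (B.get t) =
        (if B.get t = d then 1 - δ else 1) *
          (if B.get t = neighborDigit d ∧ d < Q (j + t) then 1 + δ else 1) := by
      intro t
      have h2 := h t
      have h3 := neighborDigit_ne d
      unfold biasDensity
      by_cases h4 : B.get t = d
      · rw [if_pos (h4 ▸ h2), if_pos h4, if_pos h4, h4, if_neg h3.symm,
          if_neg fun hc => h3.symm hc.1]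
        ring
      · by_cases h5 : d < Q (j + t)
        · rw [if_pos h5, if_neg h4, if_neg h4]
          by_cases h6 : B.get t = neighborDigit d
          · rw [if_pos h6, if_pos ⟨h6, h5⟩]; ring
          · rw [if_neg h6, if_neg fun hc => h6 hc.1]; ring
        · rw [if_neg h5, if_neg h4, if_neg fun hc => h5 hc.2]; ring
    rw [Finset.prod_congr rfl fun t _ => h1 t, Finset.prod_mul_distrib, Finset.prod_ite,
      Finset.prod_ite]
    simp [favoredCount]
  · have : occurrenceProb Q B j = 0 := by rw [occurrenceProb, if_neg h, zero_div]
    simp [this]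

/-- The expected count of the starting positions where the bias favors exactly `b` entries. -/
noncomputable def favoredExpectedCount (Q : ℕ → ℕ) (d : ℕ) (B : List ℕ) (b n : ℕ) : ℝ :=
  ∑ j ∈ Finset.range n, if favoredCount Q d B j = b then occurrenceProb Q B j else 0

theorem weightedCount_eq_sum_favored (Q : ℕ → ℕ) (d : ℕ) (δ : ℝ) (B : List ℕ) (n : ℕ) :
    weightedCount (biasedWeight Q d δ) B n =
      (1 - δ) ^ (Finset.univ.filter fun t : Fin B.length => B.get t = d).card *
        ∑ b : Fin (B.length + 1), favoredExpectedCount Q d B b n * (1 + δ) ^ (b : ℕ) := by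
  rw [weightedCount_biasedWeight]
  simp_rw [prod_biasDensity_mul, favoredExpectedCount, Finset.sum_mul]
  rw [Finset.sum_comm, Finset.mul_sum]
  refine Finset.sum_congr rfl fun j _ => ?_
  rw [mul_assoc]
  congr 1
  rw [Finset.sum_eq_single ⟨favoredCount Q d B j,
    Nat.lt_succ_of_le (favoredCount_le Q d B j)⟩]
  · simp [mul_comm]
  · intro b _ hb
    rw [if_neg fun h => hb (Fin.ext h.symm), zero_mul]
  · simp

theorem favoredExpectedCount_div_mem_Icc (Q : ℕ → ℕ) (d : ℕ) (B : List ℕ) (b n : ℕ) :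
    favoredExpectedCount Q d B b n / expectedCount Q B n ∈ Set.Icc (0 : ℝ) 1 := by
  have h1 : ∀ j, 0 ≤ if favoredCount Q d B j = b then occurrenceProb Q B j else 0 := fun j => by
    split_ifs
    · exact occurrenceProb_nonneg Q B j
    · exact le_rfl
  refine ⟨div_nonneg (Finset.sum_nonneg fun j _ => h1 j) (expectedCount_nonneg Q B n),
    div_le_one_of_le₀ (Finset.sum_le_sum fun j _ => ?_) (expectedCount_nonneg Q B n)⟩
  change _ ≤ occurrenceProb Q B j
  by_cases h : favoredCount Q d B j = b <;> simp [h, occurrenceProb_nonneg Q B j]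

/-- Along a suitable sequence of lengths, the effect of the bias on a block that contains `d` has a
limit, which is a polynomial in `δ` that vanishes at `1`. -/
theorem exists_subseq_tendsto_weightedCount_div (Q : ℕ → ℕ) {d : ℕ} {B : List ℕ} (hd : d ∈ B) :
    ∃ φ : ℕ → ℕ, StrictMono φ ∧ ∃ p : Polynomial ℝ, p.eval 1 = 0 ∧ ∀ δ : ℝ,
      Tendsto (fun n => weightedCount (biasedWeight Q d δ) B (φ n) / expectedCount Q B (φ n))
        atTop (𝓝 (p.eval δ)) := by
  set r : ℕ → Fin (B.length + 1) → ℝ := fun n b =>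
    favoredExpectedCount Q d B b n / expectedCount Q B n with hr
  have hcomp : IsCompact (Set.pi Set.univ fun _ : Fin (B.length + 1) => Set.Icc (0 : ℝ) 1) :=
    isCompact_univ_pi fun _ => isCompact_Icc
  obtain ⟨lam, -, φ, hφ, hlim⟩ := hcomp.tendsto_subseq (x := r)
    fun n b _ => favoredExpectedCount_div_mem_Icc Q d B b n
  set a := (Finset.univ.filter fun t : Fin B.length => B.get t = d).card with ha
  have ha0 : a ≠ 0 := by
    obtain ⟨t, ht⟩ := List.get_of_mem hd
    exact Finset.card_ne_zero.2 ⟨t, by simpa using ht⟩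
  refine ⟨φ, hφ, (1 - Polynomial.X) ^ a * ∑ b : Fin (B.length + 1),
    Polynomial.C (lam b) * (1 + Polynomial.X) ^ (b : ℕ), by simp [ha0], fun δ => ?_⟩
  simp only [Polynomial.eval_mul, Polynomial.eval_pow, Polynomial.eval_sub, Polynomial.eval_one,
    Polynomial.eval_X, Polynomial.eval_finsetSum, Polynomial.eval_add, Polynomial.eval_C]
  have h1 : Tendsto (fun n => (1 - δ) ^ a *
      ∑ b : Fin (B.length + 1), r (φ n) b * (1 + δ) ^ (b : ℕ)) atTop
      (𝓝 ((1 - δ) ^ a * ∑ b : Fin (B.length + 1), lam b * (1 + δ) ^ (b : ℕ))) :=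
    (tendsto_finsetSum _ fun b _ => ((tendsto_pi_nhds.1 hlim b).mul_const _)).const_mul _
  refine h1.congr fun n => ?_
  rw [weightedCount_eq_sum_favored, mul_div_assoc, Finset.sum_div]
  congr 1
  exact Finset.sum_congr rfl fun b _ => by rw [hr, div_mul_eq_mul_div]

/-- There are digit sequences arbitrarily close to being normal in which a given block `B` occurs
with a wrong frequency, while the blocks that avoid an entry `d` of `B` and its neighbor have the
correct frequency. -/
theorem exists_biased_digits {Q : ℕ → ℕ} (hQ : IsBasicSequence Q) {B : List ℕ}
    (hB : HasInfiniteExpectation Q B) {d : ℕ} (hd : d ∈ B) :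
    ∃ φ : ℕ → ℕ, StrictMono φ ∧ ∃ (y : ℕ → ℕ → ℕ) (ρ : ℕ → ℝ), (∀ c j, y c j < Q j) ∧
      (∀ c, ρ c ≠ 1) ∧
      (∀ c, Tendsto (fun n => (digitCount (y c) B (φ n) : ℝ) / expectedCount Q B (φ n)) atTop
        (𝓝 (ρ c))) ∧
      (∀ B', HasInfiniteExpectation Q B' → d ∉ B' → neighborDigit d ∉ B' → ∀ c,
        Tendsto (fun n => (digitCount (y c) B' n : ℝ) / expectedCount Q B' n) atTop (𝓝 1)) ∧
      ∀ B', HasInfiniteExpectation Q B' → ∃ η : ℕ → ℝ, Tendsto η atTop (𝓝 0) ∧ ∀ c, ∀ᶠ n in atTop,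
        |(digitCount (y c) B' n : ℝ) - expectedCount Q B' n| ≤ η c * expectedCount Q B' n := by
  obtain ⟨φ, hφ, p, hp1, hp⟩ := exists_subseq_tendsto_weightedCount_div Q hd
  have hδ : ∀ c : ℕ, ∃ δ : ℝ, 0 < δ ∧ δ < 1 / ((c : ℝ) + 1) ∧ p.eval δ ≠ 1 := by
    intro c
    have hp0 : p - 1 ≠ 0 := fun h => by
      have := congrArg (Polynomial.eval 1) h
      simp [hp1] at this
    obtain ⟨δ, h1, h2⟩ := ((Set.Ioo_infinite (a := (0 : ℝ)) (b := 1 / ((c : ℝ) + 1))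
      (by positivity)).sdiff (p - 1).roots.toFinset.finite_toSet).nonempty
    refine ⟨δ, h1.1, h1.2, fun h => h2 ?_⟩
    simp [hp0, h]
  choose δ hδ0 hδ2 hδp using hδ
  have hδ1 : ∀ c, δ c < 1 := fun c => (hδ2 c).trans_le (by
    rw [div_le_one (by positivity)]; linarith [(Nat.cast_nonneg c : (0 : ℝ) ≤ c)])
  have hδt : Tendsto δ atTop (𝓝 0) := squeeze_zero (fun c => (hδ0 c).le) (fun c => (hδ2 c).le)
    tendsto_one_div_add_atTop_nhds_zero_nat
  choose y hyQ hy using fun c => exists_digits_tendsto_digitCount_div (Q := Q)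
    (biasedWeight Q d (δ c)) (biasedWeight_nonneg (hδ0 c).le (hδ1 c).le Q d)
    (fun j e h => if_neg (not_lt.2 h)) (sum_biasedWeight hQ d (δ c))
  have hinf : ∀ c B', HasInfiniteExpectation Q B' →
      Tendsto (weightedCount (biasedWeight Q d (δ c)) B') atTop atTop := fun c B' h =>
    tendsto_atTop_mono (le_weightedCount (hδ0 c).le (hδ1 c).le Q d B')
      (h.const_mul_atTop (pow_pos (by linarith [hδ1 c]) _))
  refine ⟨φ, hφ, y, fun c => p.eval (δ c), hyQ, hδp, fun c => ?_, fun B' hB' h1 h2 c => ?_,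
    fun B' hB' => ?_⟩
  · have h1 := ((hy c B (hinf c B hB)).comp hφ.tendsto_atTop).mul (hp (δ c))
    rw [one_mul] at h1
    refine h1.congr' ?_
    filter_upwards [((hinf c B hB).comp hφ.tendsto_atTop).eventually_gt_atTop 0] with n hn
    rw [Function.comp_apply] at hn
    rw [Function.comp_apply, div_mul_div_cancel₀ hn.ne']
  · refine (hy c B' (hinf c B' hB')).congr fun n => ?_
    rw [weightedCount_eq_expectedCount Q _ h1 h2]
  · refine ⟨fun c => (1 + δ c) ^ (B'.length + 1) - (1 - δ c) ^ (B'.length + 1), ?_, fun c => ?_⟩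
    · have h1 := ((hδt.const_add 1).pow (B'.length + 1)).sub ((hδt.const_sub 1).pow (B'.length + 1))
      simpa using h1
    · have hδ0' := hδ0 c
      have hδ1' := hδ1 c
      have hlim := hy c B' (hinf c B' hB')
      filter_upwards [hlim.eventually_lt_const (show (1 : ℝ) < 1 + δ c by linarith),
        hlim.eventually_const_lt (show 1 - δ c < 1 by linarith),
        (hinf c B' hB').eventually_gt_atTop 0] with n h1 h2 h3
      rw [div_lt_iff₀ h3] at h1
      rw [lt_div_iff₀ h3] at h2
      have h4 := le_weightedCount hδ0'.le hδ1'.le Q d B' n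
      have h5 := weightedCount_le hδ0'.le hδ1'.le Q d B' n
      have hE := expectedCount_nonneg Q B' n
      have h6 : (digitCount (y c) B' n : ℝ) ≤ (1 + δ c) ^ (B'.length + 1) * expectedCount Q B' n := by
        rw [pow_succ']
        have := mul_le_mul_of_nonneg_left h5 (show 0 ≤ 1 + δ c by linarith)
        linarith
      have h7 : (1 - δ c) ^ (B'.length + 1) * expectedCount Q B' n ≤ digitCount (y c) B' n := by
        rw [pow_succ']
        have := mul_le_mul_of_nonneg_left h4 (show 0 ≤ 1 - δ c by linarith)
        linarith
      have h8 : (1 - δ c) ^ (B'.length + 1) ≤ 1 := pow_le_one₀ (by linarith) (by linarith)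
      have h9 : 1 ≤ (1 + δ c) ^ (B'.length + 1) := one_le_pow₀ (by linarith)
      rw [abs_le]
      constructor <;> nlinarith

/-! # Gluing digit sequences along windows -/

/-- The window `[e m, e (m + 1))` that contains `j`. -/
def windowIndex (e : ℕ → ℕ) (j : ℕ) : ℕ := Nat.findGreatest (fun m => e m ≤ j) j

theorem windowIndex_spec {e : ℕ → ℕ} (he : StrictMono e) (he0 : e 0 = 0) (j : ℕ) :
    e (windowIndex e j) ≤ j ∧ j < e (windowIndex e j + 1) := by
  refine ⟨Nat.findGreatest_spec (P := fun m => e m ≤ j) (Nat.zero_le j) (by simp [he0]), ?_⟩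
  by_contra! h
  have h1 : windowIndex e j + 1 ≤ j := (he.id_le _).trans h
  exact absurd (Nat.le_findGreatest (P := fun m => e m ≤ j) h1 h) (by
    change ¬ windowIndex e j + 1 ≤ windowIndex e j
    omega)

theorem windowIndex_eq {e : ℕ → ℕ} (he : StrictMono e) (he0 : e 0 = 0) {j m : ℕ} (h1 : e m ≤ j)
    (h2 : j < e (m + 1)) : windowIndex e j = m := by
  obtain ⟨h3, h4⟩ := windowIndex_spec he he0 j
  have h5 : m < windowIndex e j + 1 := he.lt_iff_lt.1 (h1.trans_lt h4)
  have h6 : windowIndex e j < m + 1 := he.lt_iff_lt.1 (h3.trans_lt h2)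
  omega

theorem tendsto_windowIndex {e : ℕ → ℕ} (he : StrictMono e) (he0 : e 0 = 0) :
    Tendsto (windowIndex e) atTop atTop := by
  refine tendsto_atTop_atTop.2 fun b => ⟨e b, fun j hj => ?_⟩
  have h := he.lt_iff_lt.1 (hj.trans_lt (windowIndex_spec he he0 j).2)
  omega

/-- The sequence that copies `y (min (β m) m)` on the `m`-th window, with a `0` at its start. -/
def gluedDigits (e : ℕ → ℕ) (y : ℕ → ℕ → ℕ) (β : ℕ → ℕ) (j : ℕ) : ℕ :=
  if j = e (windowIndex e j) then 0 else y (min (β (windowIndex e j)) (windowIndex e j)) j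

theorem gluedDigits_eq_zero {e : ℕ → ℕ} (he : StrictMono e) (he0 : e 0 = 0) (y : ℕ → ℕ → ℕ)
    (β : ℕ → ℕ) (m : ℕ) : gluedDigits e y β (e m) = 0 := by
  have h := windowIndex_eq he he0 le_rfl (he (Nat.lt_succ_self m))
  rw [gluedDigits, h, if_pos rfl]

theorem gluedDigits_eq {e : ℕ → ℕ} (he : StrictMono e) (he0 : e 0 = 0) (y : ℕ → ℕ → ℕ)
    (β : ℕ → ℕ) {m j : ℕ} (h1 : e m < j) (h2 : j < e (m + 1)) :
    gluedDigits e y β j = y (min (β m) m) j := by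
  rw [gluedDigits, windowIndex_eq he he0 h1.le h2, if_neg h1.ne']

theorem digitCount_eq_sum (a : ℕ → ℕ) (B : List ℕ) (n : ℕ) :
    (digitCount a B n : ℝ) =
      ∑ i ∈ Finset.range n, if ∀ t : Fin B.length, a (i + t) = B.get t then (1 : ℝ) else 0 := by
  rw [digitCount, Finset.card_filter]
  push_cast
  rfl

theorem digitCount_le (a : ℕ → ℕ) (B : List ℕ) (n : ℕ) : digitCount a B n ≤ n :=
  (Finset.card_filter_le _ _).trans (by simp)

/-- If two sequences agree strictly between `u` and `v`, then their numbers of occurrences of `B`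
with a start between `u` and `n ≤ v` differ by at most `|B| + 1`. -/
theorem abs_digitCount_sub_le {a a' : ℕ → ℕ} {u v n : ℕ} (h : ∀ i, u < i → i < v → a i = a' i)
    (hu : u ≤ n) (hn : n ≤ v) (B : List ℕ) :
    |((digitCount a B n : ℝ) - digitCount a B u) - (digitCount a' B n - digitCount a' B u)| ≤
      B.length + 1 := by
  simp only [digitCount_eq_sum]
  rw [← Finset.sum_Ico_eq_sub _ hu, ← Finset.sum_Ico_eq_sub _ hu, ← Finset.sum_sub_distrib]
  refine (Finset.abs_sum_le_sum_abs _ _).trans ?_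
  set T : Finset ℕ := insert u (Finset.Ico (n - B.length) n) with hT
  have hle : ∀ i ∈ Finset.Ico u n,
      |(if ∀ t : Fin B.length, a (i + t) = B.get t then (1 : ℝ) else 0) -
        if ∀ t : Fin B.length, a' (i + t) = B.get t then (1 : ℝ) else 0| ≤
      if i ∈ T then 1 else 0 := by
    intro i hi
    rw [Finset.mem_Ico] at hi
    by_cases hiT : i ∈ T
    · rw [if_pos hiT]
      split_ifs <;> norm_num
    · rw [if_neg hiT]
      have h1 : i ≠ u ∧ i < n - B.length := by
        rw [hT, Finset.mem_insert, Finset.mem_Ico] at hiT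
        omega
      have h2 : (∀ t : Fin B.length, a (i + t) = B.get t) ↔
          ∀ t : Fin B.length, a' (i + t) = B.get t :=
        forall_congr' fun t => by rw [h (i + t) (by omega) (by omega)]
      simp only [h2, sub_self, abs_zero, le_refl]
  refine (Finset.sum_le_sum hle).trans ?_
  rw [← Finset.sum_filter, Finset.sum_const, nsmul_eq_mul, mul_one]
  have h3 : (Finset.filter (fun i => i ∈ T) (Finset.Ico u n)).card ≤ B.length + 1 := by
    refine (Finset.card_le_card (t := T) fun j hj => (Finset.mem_filter.1 hj).2).trans
      ((Finset.card_insert_le _ _).trans ?_)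
    rw [Nat.card_Ico]
    omega
  exact_mod_cast h3

theorem tendsto_min_self {β : ℕ → ℕ} (hβ : Tendsto β atTop atTop) :
    Tendsto (fun m => min (β m) m) atTop atTop :=
  tendsto_atTop.2 fun b => by
    filter_upwards [hβ.eventually_ge_atTop b, eventually_ge_atTop b] with m h1 h2
    exact le_min h1 h2

section Scale

variable {Q : ℕ → ℕ} {e : ℕ → ℕ} {y : ℕ → ℕ → ℕ} {B : List ℕ}

theorem tendsto_digitCount_gluedDigits (he : StrictMono e) (he0 : e 0 = 0) {η : ℕ → ℝ}
    (hη0 : ∀ c, 0 ≤ η c) (hη : Tendsto η atTop (𝓝 0))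
    (hscale : ∀ᶠ m in atTop, ∀ n ≥ e (m + 1),
      (m + 1 : ℝ) * (e m + B.length + 1) ≤ expectedCount Q B n)
    (hy : ∀ᶠ m in atTop, ∀ n ≥ e (m + 1), ∀ c ≤ m + 1,
      |(digitCount (y c) B n : ℝ) - expectedCount Q B n| ≤ η c * expectedCount Q B n)
    {β : ℕ → ℕ} (hβ : Tendsto β atTop atTop) :
    Tendsto (fun n => (digitCount (gluedDigits e y β) B n : ℝ) / expectedCount Q B n) atTop
      (𝓝 1) := by
  set z := gluedDigits e y β with hz
  set γ : ℕ → ℕ := fun m => min (β m) m with hγ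
  set θ : ℕ → ℝ := fun m => 2 * η (γ (m + 1)) + η (γ m) + 2 / (m + 1) with hθ
  have hγt := tendsto_min_self hβ
  have hθt : Tendsto θ atTop (𝓝 0) := by
    have h1 := ((hη.comp (hγt.comp (tendsto_add_atTop_nat 1))).const_mul 2).add (hη.comp hγt)
    have h2 := h1.add ((tendsto_one_div_add_atTop_nhds_zero_nat (𝕜 := ℝ)).const_mul 2)
    simp only [mul_zero, add_zero] at h2
    refine h2.congr fun m => ?_
    simp only [Function.comp_apply, hθ, hγ]
    ring
  have hbound : ∀ᶠ m in atTop, ∀ n, e (m + 1) ≤ n → n < e (m + 2) →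
      |(digitCount z B n : ℝ) / expectedCount Q B n - 1| ≤ θ m := by
    filter_upwards [hscale, hy] with m hm1 hm2 n hn1 hn2
    have hs := hm1 n hn1
    have hE : 0 < expectedCount Q B n := lt_of_lt_of_le (by positivity) hs
    have hEm := expectedCount_mono Q B hn1
    have h1 := abs_digitCount_sub_le (a := z) (a' := y (γ (m + 1)))
      (fun i => gluedDigits_eq he he0 y β (m := m + 1)) hn1 hn2.le B
    have h2 := abs_digitCount_sub_le (a := z) (a' := y (γ m))
      (fun i => gluedDigits_eq he he0 y β (m := m)) (he (Nat.lt_succ_self m)).le le_rfl B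
    have hc1 : γ (m + 1) ≤ m + 1 := min_le_right _ _
    have hc2 : γ m ≤ m + 1 := (min_le_right _ _).trans (Nat.le_succ m)
    have h3 := hm2 n hn1 _ hc1
    have h4 := hm2 _ le_rfl _ hc1
    have h5 := hm2 _ le_rfl _ hc2
    have h6 := mul_le_mul_of_nonneg_left hEm (hη0 (γ (m + 1)))
    have h7 := mul_le_mul_of_nonneg_left hEm (hη0 (γ m))
    have h8 : (digitCount z B (e m) : ℝ) ≤ e m := by exact_mod_cast digitCount_le _ _ _
    have h9 : (digitCount (y (γ m)) B (e m) : ℝ) ≤ e m := by exact_mod_cast digitCount_le _ _ _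
    have h10 : (0 : ℝ) ≤ digitCount z B (e m) := by positivity
    have h11 : (0 : ℝ) ≤ digitCount (y (γ m)) B (e m) := by positivity
    have h12 : 2 * ((e m : ℝ) + B.length + 1) ≤ 2 / (m + 1) * expectedCount Q B n := by
      rw [div_mul_eq_mul_div, le_div_iff₀ (by positivity)]
      linarith
    rw [div_sub_one hE.ne', abs_div, abs_of_pos hE, div_le_iff₀ hE]
    simp only [hθ, add_mul]
    rw [abs_le] at h1 h2 h3 h4 h5 ⊢
    constructor <;> linarith
  have hw := tendsto_windowIndex he he0
  have hw1 : Tendsto (fun n => windowIndex e n - 1) atTop atTop := (tendsto_sub_atTop_nat 1).comp hw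
  rw [tendsto_iff_dist_tendsto_zero]
  refine squeeze_zero' (Eventually.of_forall fun _ => dist_nonneg) ?_ (hθt.comp hw1)
  filter_upwards [hw1.eventually hbound, hw.eventually_ge_atTop 1] with n hn h1
  obtain ⟨h2, h3⟩ := windowIndex_spec he he0 n
  rw [Real.dist_eq]
  refine hn n ?_ ?_
  · rwa [Nat.sub_add_cancel h1]
  · rwa [show windowIndex e n - 1 + 2 = windowIndex e n + 1 by omega]

theorem tendsto_digitCount_gluedDigits_window_end (he : StrictMono e) (he0 : e 0 = 0)
    (hscale : ∀ᶠ m in atTop, ∀ n ≥ e (m + 1),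
      (m + 1 : ℝ) * (e m + B.length + 1) ≤ expectedCount Q B n) {c : ℕ} {r : ℝ}
    (hy : Tendsto (fun m => (digitCount (y c) B (e (m + 1)) : ℝ) / expectedCount Q B (e (m + 1)))
      atTop (𝓝 r)) (β : ℕ → ℕ) :
    Tendsto (fun m => (digitCount (gluedDigits e y β) B (e (m + 1)) : ℝ) /
      expectedCount Q B (e (m + 1))) (atTop ⊓ 𝓟 {m | min (β m) m = c}) (𝓝 r) := by
  set z := gluedDigits e y β with hz
  have hlim : Tendsto (fun m : ℕ => 2 * (1 / ((m : ℝ) + 1))) (atTop ⊓ 𝓟 {m | min (β m) m = c})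
      (𝓝 0) := by
    have := (tendsto_one_div_add_atTop_nhds_zero_nat (𝕜 := ℝ)).const_mul 2
    rw [mul_zero] at this
    exact this.mono_left inf_le_left
  have hdiff : Tendsto (fun m => (digitCount z B (e (m + 1)) : ℝ) / expectedCount Q B (e (m + 1)) -
      (digitCount (y c) B (e (m + 1)) : ℝ) / expectedCount Q B (e (m + 1)))
      (atTop ⊓ 𝓟 {m | min (β m) m = c}) (𝓝 0) := by
    refine squeeze_zero_norm' ?_ hlim
    refine eventually_inf_principal.2 ?_
    filter_upwards [hscale] with m hm hc
    have hs := hm _ le_rfl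
    have hE : 0 < expectedCount Q B (e (m + 1)) := lt_of_lt_of_le (by positivity) hs
    have h1 := abs_digitCount_sub_le (a := z) (a' := y (min (β m) m))
      (fun i => gluedDigits_eq he he0 y β (m := m)) (he (Nat.lt_succ_self m)).le le_rfl B
    rw [show min (β m) m = c from hc] at h1
    have h8 : (digitCount z B (e m) : ℝ) ≤ e m := by exact_mod_cast digitCount_le _ _ _
    have h9 : (digitCount (y c) B (e m) : ℝ) ≤ e m := by exact_mod_cast digitCount_le _ _ _
    have h10 : (0 : ℝ) ≤ digitCount z B (e m) := by positivity
    have h11 : (0 : ℝ) ≤ digitCount (y c) B (e m) := by positivity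
    have h12 : 2 * ((e m : ℝ) + B.length + 1) ≤
        2 * (1 / (m + 1)) * expectedCount Q B (e (m + 1)) := by
      rw [mul_one_div, div_mul_eq_mul_div, le_div_iff₀ (by positivity)]
      linarith
    have h13 : (0 : ℝ) ≤ B.length := by positivity
    have h14 : (0 : ℝ) ≤ e m := by positivity
    rw [← sub_div, Real.norm_eq_abs, abs_div, abs_of_pos hE, div_le_iff₀ hE]
    rw [abs_le] at h1 ⊢
    constructor <;> linarith
  have h := hdiff.add (hy.mono_left inf_le_left)
  simpa using h

end Scale

/-! # Real numbers with given digits -/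

section Expansion

variable {Q : ℕ → ℕ}

/-- The number in `[0, 1]` with the digits `a`. -/
noncomputable def cantorValue (Q a : ℕ → ℕ) : ℝ :=
  ∑' i, (a i : ℝ) / ∏ j ∈ Finset.range (i + 1), (Q j : ℝ)

theorem prod_base_pos (hQ : IsBasicSequence Q) (n : ℕ) :
    0 < ∏ j ∈ Finset.range n, (Q j : ℝ) :=
  Finset.prod_pos fun j _ => by have := hQ j; positivity

theorem two_pow_le_prod_base (hQ : IsBasicSequence Q) (n : ℕ) :
    (2 : ℝ) ^ n ≤ ∏ j ∈ Finset.range n, (Q j : ℝ) := by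
  calc (2 : ℝ) ^ n = ∏ j ∈ Finset.range n, (2 : ℝ) := by simp
    _ ≤ _ := Finset.prod_le_prod (fun _ _ => by norm_num) fun j _ => by exact_mod_cast hQ j

theorem digit_div_prod_le (hQ : IsBasicSequence Q) {a : ℕ → ℕ} (ha : ∀ j, a j < Q j) (i : ℕ) :
    (a i : ℝ) / ∏ j ∈ Finset.range (i + 1), (Q j : ℝ) ≤
      (∏ j ∈ Finset.range i, (Q j : ℝ))⁻¹ - (∏ j ∈ Finset.range (i + 1), (Q j : ℝ))⁻¹ := by
  have h1 := prod_base_pos hQ i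
  have h2 : (0 : ℝ) < Q i := by have := hQ i; positivity
  have h3 : (a i : ℝ) + 1 ≤ Q i := by exact_mod_cast ha i
  have h4 : (∏ j ∈ Finset.range i, (Q j : ℝ))⁻¹ = Q i / ∏ j ∈ Finset.range (i + 1), (Q j : ℝ) := by
    rw [Finset.prod_range_succ]; field_simp
  rw [h4, ← one_div, ← sub_div]
  exact div_le_div_of_nonneg_right (by linarith) (prod_base_pos hQ _).le

theorem digit_div_prod_le_half_pow (hQ : IsBasicSequence Q) {a : ℕ → ℕ} (ha : ∀ j, a j < Q j)
    (i : ℕ) : (a i : ℝ) / ∏ j ∈ Finset.range (i + 1), (Q j : ℝ) ≤ (1 / 2) ^ i := by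
  have h1 := digit_div_prod_le hQ ha i
  have h2 := inv_pos.2 (prod_base_pos hQ (i + 1))
  have h3 := inv_anti₀ (by positivity) (two_pow_le_prod_base hQ i)
  rw [one_div, inv_pow]
  linarith

theorem summable_digit_div_prod (hQ : IsBasicSequence Q) {a : ℕ → ℕ} (ha : ∀ j, a j < Q j) :
    Summable fun i => (a i : ℝ) / ∏ j ∈ Finset.range (i + 1), (Q j : ℝ) :=
  Summable.of_nonneg_of_le (fun i => div_nonneg (by positivity) (prod_base_pos hQ _).le)
    (digit_div_prod_le_half_pow hQ ha) (summable_geometric_of_lt_one (by norm_num) (by norm_num))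

theorem cantorDigit_cantorValue (hQ : IsBasicSequence Q) {a : ℕ → ℕ} (ha : ∀ j, a j < Q j)
    (ha0 : a 0 = 0) (hfr : ∃ᶠ i in atTop, a i ≠ Q i - 1) :
    cantorDigit Q (cantorValue Q a) = a := by
  have hsum := summable_digit_div_prod hQ ha
  have hnn : 0 ≤ cantorValue Q a :=
    tsum_nonneg fun i => div_nonneg (by positivity) (prod_base_pos hQ _).le
  have hpart : ∀ n, ∑ i ∈ Finset.range (n + 1),
      (a i : ℝ) / ∏ j ∈ Finset.range (i + 1), (Q j : ℝ) ≤
      (Q 0 : ℝ)⁻¹ - (∏ j ∈ Finset.range (n + 1), (Q j : ℝ))⁻¹ := by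
    intro n
    induction n with
    | zero => simp [ha0]
    | succ n ih =>
      rw [Finset.sum_range_succ]
      linarith [digit_div_prod_le hQ ha (n + 1)]
  have hlt : cantorValue Q a < 1 := by
    have h1 : cantorValue Q a ≤ (Q 0 : ℝ)⁻¹ := by
      refine le_of_tendsto (hsum.hasSum.tendsto_sum_nat.comp (tendsto_add_atTop_nat 1))
        (Eventually.of_forall fun n => (hpart n).trans ?_)
      linarith [inv_pos.2 (prod_base_pos hQ (n + 1))]
    refine h1.trans_lt (inv_lt_one_of_one_lt₀ ?_)
    exact_mod_cast hQ 0
  have hfloor : ⌊cantorValue Q a⌋ = 0 := Int.floor_eq_zero_iff.2 ⟨hnn, hlt⟩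
  refine (((isCantorExpansion_iff hQ _ 0 a).1 ⟨hfloor.symm, ha, hfr, ?_⟩).2).symm
  simpa [cantorValue] using hsum.hasSum

end Expansion

/-- A continuous map from the Baire space that takes the sequences tending to infinity to normal
numbers, and all others to numbers in which a given block `B` occurs with a wrong frequency along
some filter along which the blocks that avoid an entry `d` of `B` and its neighbor have the correct
frequency. -/
theorem exists_continuous_normal_iff {Q : ℕ → ℕ} (hQ : IsBasicSequence Q) {B : List ℕ}
    (hB : HasInfiniteExpectation Q B) {d : ℕ} (hd : d ∈ B) :
    ∃ f : (ℕ → ℕ) → ℝ, Continuous f ∧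
      (∀ β, Tendsto β atTop atTop → f β ∈ normalSet Q Set.univ) ∧
      ∀ β, ¬ Tendsto β atTop atTop → ∃ F : Filter ℕ, F.NeBot ∧ F ≤ atTop ∧ ∃ ρ : ℝ, ρ ≠ 1 ∧
        Tendsto (fun n => (blockCount Q B (f β) n : ℝ) / expectedCount Q B n) F (𝓝 ρ) ∧
        ∀ B', HasInfiniteExpectation Q B' → d ∉ B' → neighborDigit d ∉ B' →
          Tendsto (fun n => (blockCount Q B' (f β) n : ℝ) / expectedCount Q B' n) F (𝓝 1) := by
  obtain ⟨φ, hφ, y, ρ, hyQ, hρ, hyB, hyB', hyη⟩ := exists_biased_digits hQ hB hd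
  have hη : ∀ B', ∃ η : ℕ → ℝ, Tendsto η atTop (𝓝 0) ∧ (∀ c, 0 ≤ η c) ∧
      (HasInfiniteExpectation Q B' → ∀ c, ∀ᶠ n in atTop,
        |(digitCount (y c) B' n : ℝ) - expectedCount Q B' n| ≤ η c * expectedCount Q B' n) := by
    intro B'
    by_cases h : HasInfiniteExpectation Q B'
    · obtain ⟨η, h1, h2⟩ := hyη B' h
      refine ⟨fun c => |η c|, by simpa using h1.abs, fun c => abs_nonneg _, fun _ c => ?_⟩
      filter_upwards [h2 c] with n hn
      exact hn.trans (mul_le_mul_of_nonneg_right (le_abs_self _) (expectedCount_nonneg Q B' n))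
    · exact ⟨fun _ => 0, tendsto_const_nhds, fun _ => le_rfl, fun h' => absurd h' h⟩
  choose η hηt hη0 hηy using hη
  let P : ℕ → ℕ → ℕ → List ℕ → Prop := fun m a n B' =>
    (m + 1 : ℝ) * (a + B'.length + 1) ≤ expectedCount Q B' n ∧ ∀ c ≤ m + 1,
      |(digitCount (y c) B' n : ℝ) - expectedCount Q B' n| ≤ η B' c * expectedCount Q B' n
  let R : ℕ → ℕ → ℕ → Prop := fun m a b => a < b ∧ (∃ k ≥ m, b = φ k) ∧
    ∀ B', Encodable.encode B' ≤ m → HasInfiniteExpectation Q B' → ∀ n ≥ b, P m a n B'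
  have step : ∀ m a, ∃ b, R m a b := by
    intro m a
    have hfin : {B' : List ℕ | Encodable.encode B' ≤ m}.Finite :=
      (Set.finite_Iic m).preimage Encodable.encode_injective.injOn
    have h1 : ∀ᶠ n in atTop, ∀ B' ∈ {B' : List ℕ | Encodable.encode B' ≤ m},
        HasInfiniteExpectation Q B' → P m a n B' := by
      refine (eventually_all_finite hfin).2 fun B' _ => ?_
      by_cases h : HasInfiniteExpectation Q B'
      · have h2 : ∀ᶠ n in atTop, ∀ c ∈ Set.Iic (m + 1),
            |(digitCount (y c) B' n : ℝ) - expectedCount Q B' n| ≤ η B' c * expectedCount Q B' n :=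
          (eventually_all_finite (Set.finite_Iic _)).2 fun c _ => hηy B' h c
        filter_upwards [h2, h.eventually_ge_atTop ((m + 1 : ℝ) * (a + B'.length + 1))]
          with n hn1 hn2 _
        exact ⟨hn2, hn1⟩
      · exact Eventually.of_forall fun n h' => absurd h' h
    obtain ⟨k, ⟨hk1, hk2⟩, hk3⟩ := ((hφ.tendsto_atTop.eventually
      ((eventually_forall_ge_atTop.2 h1).and (eventually_gt_atTop a))).and (eventually_ge_atTop m)).exists
    exact ⟨φ k, hk2, ⟨k, hk3, rfl⟩, fun B' hB' h n hn => hk1 n hn B' hB' h⟩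
  obtain ⟨e, he0, heR⟩ := exists_seq_of_forall_exists_rel 0 R step
  have he : StrictMono e := strictMono_nat_of_lt_succ fun m => (heR m).1
  have hscale : ∀ B', HasInfiniteExpectation Q B' → ∀ᶠ m in atTop, ∀ n ≥ e (m + 1),
      (m + 1 : ℝ) * (e m + B'.length + 1) ≤ expectedCount Q B' n := fun B' h => by
    filter_upwards [eventually_ge_atTop (Encodable.encode B')] with m hm n hn
    exact ((heR m).2.2 B' hm h n hn).1
  have hyscale : ∀ B', HasInfiniteExpectation Q B' → ∀ᶠ m in atTop, ∀ n ≥ e (m + 1), ∀ c ≤ m + 1,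
      |(digitCount (y c) B' n : ℝ) - expectedCount Q B' n| ≤ η B' c * expectedCount Q B' n :=
    fun B' h => by
      filter_upwards [eventually_ge_atTop (Encodable.encode B')] with m hm n hn
      exact ((heR m).2.2 B' hm h n hn).2
  have hzQ : ∀ β j, gluedDigits e y β j < Q j := fun β j => by
    unfold gluedDigits
    split_ifs
    · have := hQ j; omega
    · exact hyQ _ j
  have hz0 : ∀ β, gluedDigits e y β 0 = 0 := fun β => by
    simpa [he0] using gluedDigits_eq_zero he he0 y β 0
  have hzfr : ∀ β, ∃ᶠ i in atTop, gluedDigits e y β i ≠ Q i - 1 := fun β =>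
    frequently_atTop.2 fun N => ⟨e N, he.id_le N, by
      rw [gluedDigits_eq_zero he he0]
      have := hQ (e N)
      omega⟩
  have hdig : ∀ β, cantorDigit Q (cantorValue Q (gluedDigits e y β)) = gluedDigits e y β :=
    fun β => cantorDigit_cantorValue hQ (hzQ β) (hz0 β) (hzfr β)
  have hcount : ∀ β B' n, blockCount Q B' (cantorValue Q (gluedDigits e y β)) n =
      digitCount (gluedDigits e y β) B' n := fun β B' n => by
    rw [blockCount, digitCount, hdig]
  refine ⟨fun β => cantorValue Q (gluedDigits e y β), ?_, fun β hβ B' _ hB' => ?_, fun β hβ => ?_⟩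
  · refine continuous_tsum (fun i => ?_) (summable_geometric_of_lt_one
      (show (0 : ℝ) ≤ 1 / 2 by norm_num) (by norm_num)) fun i β => ?_
    · have h1 : Continuous fun β : ℕ → ℕ => gluedDigits e y β i := by
        unfold gluedDigits
        split_ifs
        · exact continuous_const
        · exact (continuous_of_discreteTopology (f := fun b : ℕ =>
            y (min b (windowIndex e i)) i)).comp (continuous_apply (windowIndex e i))
      exact ((continuous_of_discreteTopology (f := fun b : ℕ => (b : ℝ))).comp h1).div_const _
    · rw [Real.norm_of_nonneg (div_nonneg (by positivity) (prod_base_pos hQ _).le)]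
      exact digit_div_prod_le_half_pow hQ (hzQ β) i
  · simp only [hcount]
    exact tendsto_digitCount_gluedDigits he he0 (hη0 B') (hηt B') (hscale B' hB')
      (hyscale B' hB') hβ
  · obtain ⟨c, hc⟩ : ∃ c, ∃ᶠ m in atTop, min (β m) m = c := by
      rw [tendsto_atTop] at hβ
      push Not at hβ
      obtain ⟨b, hb⟩ := hβ
      by_contra! hcon
      have h1 : ∀ᶠ m in atTop, ∀ c ∈ Set.Iio b, ¬ min (β m) m = c :=
        (eventually_all_finite (Set.finite_Iio b)).2 fun c _ => hcon c
      obtain ⟨m, hm1, hm2⟩ := (hb.and_eventually h1).exists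
      exact hm2 _ (Set.mem_Iio.2 ((min_le_left _ _).trans_lt hm1)) rfl
    have hne : (atTop ⊓ 𝓟 {m | min (β m) m = c}).NeBot := frequently_mem_iff_neBot.1 hc
    have het : Tendsto (fun m => e (m + 1)) atTop atTop :=
      he.tendsto_atTop.comp (tendsto_add_atTop_nat 1)
    choose k hk hek using fun m => (heR m).2.1
    have hkt : Tendsto k atTop atTop := tendsto_atTop_mono hk tendsto_id
    refine ⟨Filter.map (fun m => e (m + 1)) (atTop ⊓ 𝓟 {m | min (β m) m = c}), hne.map _,
      (Filter.map_mono inf_le_left).trans het, ρ c, hρ c, ?_, fun B' hB' h1 h2 => ?_⟩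
    · simp only [hcount, tendsto_map'_iff]
      refine tendsto_digitCount_gluedDigits_window_end he he0 (hscale B hB) ?_ β
      simp only [hek]
      exact (hyB c).comp hkt
    · simp only [hcount, tendsto_map'_iff]
      exact tendsto_digitCount_gluedDigits_window_end he he0 (hscale B' hB')
        ((hyB' B' hB' h1 h2 c).comp het) β

/-! # Continuity of the digits -/

theorem eventually_floor_eq {x : ℝ} (hx : ∀ z : ℤ, x ≠ z) : ∀ᶠ y in 𝓝 x, ⌊y⌋ = ⌊x⌋ := by
  have h1 : (⌊x⌋ : ℝ) < x := lt_of_le_of_ne (Int.floor_le x) (hx _).symm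
  filter_upwards [Ioo_mem_nhds h1 (Int.lt_floor_add_one x)] with y hy
  exact Int.floor_eq_iff.2 ⟨hy.1.le, hy.2⟩

/-- The numbers with two Cantor series expansions in the wide sense. -/
def cantorRationals (Q : ℕ → ℕ) : Set ℝ :=
  {x | ∃ n, ∃ z : ℤ, (∏ j ∈ Finset.range n, (Q j : ℝ)) * x = z}

theorem countable_cantorRationals {Q : ℕ → ℕ} (hQ : IsBasicSequence Q) :
    (cantorRationals Q).Countable := by
  refine (Set.countable_range fun p : ℕ × ℤ =>
    (p.2 : ℝ) / ∏ j ∈ Finset.range p.1, (Q j : ℝ)).mono ?_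
  rintro x ⟨n, z, h⟩
  refine ⟨(n, z), ?_⟩
  have := (prod_base_pos hQ n).ne'
  simp only
  rw [← h]
  field_simp

theorem cantorDigit_eq_toNat (Q : ℕ → ℕ) (x : ℝ) (i : ℕ) :
    cantorDigit Q x i = (⌊(∏ j ∈ Finset.range (i + 1), (Q j : ℝ)) * x⌋ -
      Q i * ⌊(∏ j ∈ Finset.range i, (Q j : ℝ)) * x⌋).toNat := by
  rw [cantorDigit, ← Int.floor_toNat]
  congr 1
  rw [show (Q i : ℝ) * Int.fract ((∏ j ∈ Finset.range i, (Q j : ℝ)) * x) =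
    (∏ j ∈ Finset.range (i + 1), (Q j : ℝ)) * x -
      ((Q i * ⌊(∏ j ∈ Finset.range i, (Q j : ℝ)) * x⌋ : ℤ) : ℝ) by
    rw [Int.fract, Finset.prod_range_succ]; push_cast; ring, Int.floor_sub_intCast]

theorem eventually_cantorDigit_eq {Q : ℕ → ℕ} {x : ℝ} (hx : x ∉ cantorRationals Q) (i : ℕ) :
    ∀ᶠ y in 𝓝 x, cantorDigit Q y i = cantorDigit Q x i := by
  have h : ∀ n, ∀ᶠ y in 𝓝 x, ⌊(∏ j ∈ Finset.range n, (Q j : ℝ)) * y⌋ =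
      ⌊(∏ j ∈ Finset.range n, (Q j : ℝ)) * x⌋ := fun n =>
    (continuous_const_mul (∏ j ∈ Finset.range n, (Q j : ℝ))).continuousAt.eventually
      (eventually_floor_eq fun z hz => hx ⟨n, z, hz⟩)
  filter_upwards [h i, h (i + 1)] with y h1 h2
  rw [cantorDigit_eq_toNat, cantorDigit_eq_toNat, h1, h2]

theorem eventually_blockCount_eq {Q : ℕ → ℕ} {x : ℝ} (hx : x ∉ cantorRationals Q) (B : List ℕ)
    (n : ℕ) : ∀ᶠ y in 𝓝 x, blockCount Q B y n = blockCount Q B x n := by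
  have h : ∀ᶠ y in 𝓝 x, ∀ i ∈ Set.Iio (n + B.length), cantorDigit Q y i = cantorDigit Q x i :=
    (eventually_all_finite (Set.finite_Iio _)).2 fun i _ => eventually_cantorDigit_eq hx i
  filter_upwards [h] with y hy
  unfold blockCount
  congr 1
  refine Finset.filter_congr fun i hi => forall_congr' fun t => ?_
  rw [hy _ (by rw [Set.mem_Iio]; have := Finset.mem_range.1 hi; omega)]

theorem jointlyInfiniteExpectation_iff (Q : ℕ → ℕ) (B₁ B₂ : List ℕ) :
    JointlyInfiniteExpectation Q B₁ B₂ ↔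
      HasInfiniteExpectation Q B₁ ∧ HasInfiniteExpectation Q B₂ := by
  refine ⟨fun h => ⟨tendsto_atTop_mono (fun n => min_le_left _ _) h,
    tendsto_atTop_mono (fun n => min_le_right _ _) h⟩, fun h => tendsto_atTop.2 fun b => ?_⟩
  filter_upwards [h.1.eventually_ge_atTop b, h.2.eventually_ge_atTop b] with n h1 h2
  exact le_min h1 h2

/-! # Complexity of the sets of normal and ratio normal numbers -/

theorem isPiZero_three_normalSet {Q : ℕ → ℕ} (hQ : IsBasicSequence Q) (C : Set (List ℕ)) :
    IsPiZero 3 (normalSet Q C) := by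
  have h := isPiZero_three_setOf_tendsto (countable_cantorRationals hQ)
    (ι := {B : List ℕ // B ∈ C ∧ HasInfiniteExpectation Q B})
    (fun B n x => (blockCount Q B.1 x n : ℝ) / expectedCount Q B.1 n) fun B n x hx =>
      ContinuousAt.continuousWithinAt (tendsto_const_nhds.congr'
        ((eventually_blockCount_eq hx B.1 n).mono fun y hy => by simp only [hy]))
  convert h using 1
  ext x
  simp [normalSet]

theorem isPiZero_three_ratioNormalSet {Q : ℕ → ℕ} (hQ : IsBasicSequence Q) (C : Set (List ℕ)) :
    IsPiZero 3 (ratioNormalSet Q C) := by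
  have h := isPiZero_three_setOf_tendsto (countable_cantorRationals hQ)
    (ι := {p : List ℕ × List ℕ // p.1 ∈ C ∧ p.2 ∈ C ∧ p.1.length = p.2.length ∧
      JointlyInfiniteExpectation Q p.1 p.2})
    (fun p n x => ((blockCount Q p.1.1 x n : ℝ) / expectedCount Q p.1.1 n) /
      ((blockCount Q p.1.2 x n : ℝ) / expectedCount Q p.1.2 n)) fun p n x hx =>
      ContinuousAt.continuousWithinAt (tendsto_const_nhds.congr'
        (((eventually_blockCount_eq hx p.1.1 n).and (eventually_blockCount_eq hx p.1.2 n)).mono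
          fun y hy => by simp only [hy.1, hy.2]))
  convert h using 1
  ext x
  simp only [ratioNormalSet, Set.mem_ofPred_eq, Subtype.forall, Prod.forall]
  exact ⟨fun h B₁ B₂ ⟨h1, h2, h3, h4⟩ => h B₁ h1 B₂ h2 h3 h4,
    fun h B₁ h1 B₂ h2 h3 h4 => h B₁ B₂ ⟨h1, h2, h3, h4⟩⟩

theorem normalSet_univ_subset (Q : ℕ → ℕ) (C : Set (List ℕ)) :
    normalSet Q Set.univ ⊆ normalSet Q C ∩ ratioNormalSet Q C := by
  refine fun x hx => ⟨fun B _ => hx B trivial, fun B₁ _ B₂ _ _ hB => ?_⟩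
  obtain ⟨h1, h2⟩ := (jointlyInfiniteExpectation_iff Q B₁ B₂).1 hB
  have h := (hx B₁ trivial h1).div (hx B₂ trivial h2) one_ne_zero
  rwa [div_one] at h

theorem not_isSigmaZero_three_of_preimage {A : Set ℝ} {f : (ℕ → ℕ) → ℝ} (hf : Continuous f)
    (h : ∀ β, f β ∈ A ↔ Tendsto β atTop atTop) : ¬ IsSigmaZero 3 A := fun hA =>
  not_isSigmaZero_three_tendsto_atTop (by
    have h1 := hA.preimage hf
    rwa [show f ⁻¹' A = {β : ℕ → ℕ | Tendsto β atTop atTop} from Set.ext h] at h1)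

theorem not_isSigmaZero_three_normalSet {Q : ℕ → ℕ} (hQ : IsBasicSequence Q) {C : Set (List ℕ)}
    {B : List ℕ} (hBC : B ∈ C) (hne : B ≠ []) (hB : HasInfiniteExpectation Q B) :
    ¬ IsSigmaZero 3 (normalSet Q C) := by
  obtain ⟨d, hd⟩ := List.exists_mem_of_ne_nil B hne
  obtain ⟨f, hf, h1, h2⟩ := exists_continuous_normal_iff hQ hB hd
  refine not_isSigmaZero_three_of_preimage hf fun β =>
    ⟨fun h => ?_, fun h => (normalSet_univ_subset Q C (h1 β h)).1⟩
  by_contra hβ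
  obtain ⟨F, hF, hFle, ρ, hρ, hlim, -⟩ := h2 β hβ
  exact hρ (tendsto_nhds_unique hlim ((h B hBC hB).mono_left hFle))

theorem not_isSigmaZero_three_ratioNormalSet {Q : ℕ → ℕ} (hQ : IsBasicSequence Q)
    {C : Set (List ℕ)} (hC : StarCondition Q C) {B : List ℕ} (hBC : B ∈ C)
    (hB : HasInfiniteExpectation Q B) : ¬ IsSigmaZero 3 (ratioNormalSet Q C) := by
  obtain ⟨B', hBC', hB', hlen, t, ht⟩ := hC B hBC hB
  have hfar : ∀ e ∈ B', 1 < |(B.get t : ℤ) - e| := fun e he => by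
    obtain ⟨t', rfl⟩ := List.get_of_mem he
    exact ht t'
  obtain ⟨f, hf, h1, h2⟩ := exists_continuous_normal_iff hQ hB (List.get_mem B t)
  refine not_isSigmaZero_three_of_preimage hf fun β =>
    ⟨fun h => ?_, fun h => (normalSet_univ_subset Q C (h1 β h)).2⟩
  by_contra hβ
  obtain ⟨F, hF, hFle, ρ, hρ, hlim, hlim'⟩ := h2 β hβ
  have h3 := hlim' B' hB' (fun hd => by simpa using hfar _ hd)
    (fun hd => absurd (hfar _ hd) (not_lt.2 (abs_sub_neighborDigit_le _)))
  have h4 := hlim.div h3 one_ne_zero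
  rw [div_one] at h4
  exact hρ (tendsto_nhds_unique h4 ((h B hBC B' hBC' hlen.symm
    ((jointlyInfiniteExpectation_iff Q B B').2 ⟨hB, hB'⟩)).mono_left hFle))

theorem theorem4 (Q : ℕ → ℕ) (hQ : IsBasicSequence Q) (C : Set (List ℕ))
    (hC : ∀ B ∈ C, B ≠ []) :
    ((∃ B ∈ C, HasInfiniteExpectation Q B) → IsPiZeroComplete 3 (normalSet Q C)) ∧
    ((¬ ∃ B ∈ C, HasInfiniteExpectation Q B) → IsClopen (normalSet Q C)) ∧
    ((∃ B₁ ∈ C, ∃ B₂ ∈ C, JointlyInfiniteExpectation Q B₁ B₂) → StarCondition Q C →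
      IsPiZeroComplete 3 (ratioNormalSet Q C)) ∧
    ((¬ ∃ B₁ ∈ C, ∃ B₂ ∈ C, JointlyInfiniteExpectation Q B₁ B₂) →
      IsClopen (ratioNormalSet Q C)) := by
  refine ⟨?_, fun h => ?_, ?_, fun h => ?_⟩
  · rintro ⟨B, hBC, hB⟩
    exact ⟨isPiZero_three_normalSet hQ C, not_isSigmaZero_three_normalSet hQ hBC (hC B hBC) hB⟩
  · have : normalSet Q C = Set.univ :=
      Set.eq_univ_of_forall fun x B hBC hB => absurd ⟨B, hBC, hB⟩ h
    rw [this]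
    exact isClopen_univ
  · rintro ⟨B₁, hBC₁, B₂, -, hB⟩ hstar
    exact ⟨isPiZero_three_ratioNormalSet hQ C, not_isSigmaZero_three_ratioNormalSet hQ hstar hBC₁
      ((jointlyInfiniteExpectation_iff Q B₁ B₂).1 hB).1⟩
  · have : ratioNormalSet Q C = Set.univ :=
      Set.eq_univ_of_forall fun x B₁ hBC₁ B₂ hBC₂ _ hB => absurd ⟨B₁, hBC₁, B₂, hBC₂, hB⟩ h
    rw [this]
    exact isClopen_univ
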